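/- Let $G$ be an abelian group (written multiplicatively), let $\underline{g}=(g_1,\dots,g_m)\in G^m$, let $\mathrm{supp}(\underline{g})=\{g_1,\dots,g_m\}\subseteq G$, and put $$\mathcal{B}(\underline{g})=\Big\{\alpha\in\mathbb{N}_0^m \;\Big|\; \prod_{i=1}^m g_i^{\alpha_i}=1\Big\},\qquad \mathcal{B}(\mathrm{supp}(\underline{g}))=\Big\{\alpha\in\mathbb{N}_0^{\mathrm{supp}(\underline{g})} \;\Big|\; \prod_{h\in\mathrm{supp}(\underline{g})} h^{\alpha(h)}=1\Big\}.$$ For a reduced affine monoid $S$ with set of atoms $\mathcal{A}(S)$, let $M$ be the free commutative monoid of monomials $x^{\alpha}=\prod_{a}x_a^{\alpha(a)}$, $\alpha\in\mathbb{N}_0^{\mathcal{A}(S)}$, let $\pi:M\to S$ be the monoid homomorphism with $\pi(x_a)=a$, and write $x\sim_S y$ if $\pi(x)=\pi(y)$. An admissible order on $M$ is a total order $\prec$ such that $x\prec y$ implies $xz\prec yz$, and $1\prec x$ for all $x\neq 1$. A Gröbner system of $\sim_S$ with respect to $\prec$ is a finite set $\Lambda\subset M\times M$ such that (i) $x\sim_S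 y$ and $y\prec x$ for all $(x,y)\in\Lambda$, and (ii) every $z\in M$ that is divisible by no $x$ with $(x,y)\in\Lambda$ is the minimal element of its $\sim_S$-class. We say that $S$ has a quadratic Gröbner system if, for some admissible order, $\sim_S$ has a Gröbner system all of whose pairs consist of monomials of degree at most $2$ (all variables $x_a$ having degree $1$). If $\mathcal{B}(\mathrm{supp}(\underline{g}))$ has a quadratic Gröbner system, then $\mathcal{B}(\underline{g})$ also has a quadratic Gröbner system, and the semigroup algebra $\mathbb{C}[\mathcal{B}(\underline{g})]$ is Koszul. That is, giving every atom degree $1$ defines an algebra grading $A=\bigoplus_{n\ge 0}A_n$ of $A=\mathbb{C}[\mathcal{B}(\underline{g})]$ with $A_0=\mathbb{C}$, and the trivial module $A/A_+\cong\mathbb{C}$, where $A_+=\bigoplus_{n\ge1}A_n$, has a linear free resolution $$\cdots\to A(-2)^{I_2}\to A(-1)^{I_1}\to A^{I_0}\to A/A_+\to 0$$ (an exact complex of free modules in which all matrix entries of the maps between the free modules lie in $A_1$; here $A^{I}$ denotes the free module with basis $I$). -/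

import Mathlib

noncomputable section

namespace BlockMonoid

section Monoids

variable {G : Type*} [CommGroup G]

/-- The block monoid `𝓑(G₀)` of a finite subset `G₀` of an abelian group `G`: the functions
`α : G₀ → ℕ` such that `∏ h ∈ G₀, h ^ α(h) = 1`. -/
def ofFinset (G₀ : Finset G) : AddSubmonoid (G₀ → ℕ) where
  carrier := {α | ∏ h : G₀, (h : G) ^ α h = 1}
  zero_mem' := by simp
  add_mem' := by
    intro α β hα hβ
    simp only [Set.mem_ofPred_eq] at hα hβ ⊢
    simp only [Pi.add_apply, pow_add, Finset.prod_mul_distrib, hα, hβ, mul_one]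

/-- The monoid `𝓑(g)` of an `m`-tuple `g = (g₁, …, gₘ)` of not necessarily distinct elements
of `G`: the vectors `α ∈ ℕᵐ` such that `∏ i, gᵢ ^ αᵢ = 1`. -/
def ofTuple {m : ℕ} (g : Fin m → G) : AddSubmonoid (Fin m → ℕ) where
  carrier := {α | ∏ i, g i ^ α i = 1}
  zero_mem' := by simp
  add_mem' := by
    intro α β hα hβ
    simp only [Set.mem_ofPred_eq] at hα hβ ⊢
    simp only [Pi.add_apply, pow_add, Finset.prod_mul_distrib, hα, hβ, mul_one]

/-- The support `{g₁, …, gₘ}` of a tuple. -/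
def supp {m : ℕ} (g : Fin m → G) : Finset G := (Set.finite_range g).toFinset

end Monoids

section Groebner

/-- The monomials in commuting variables indexed by `σ` are written through their exponent
vectors `σ →₀ ℕ`. An admissible order is a strict total order, compatible with the
multiplication of monomials, in which the monomial `1` (exponent vector `0`) lies strictly
below every other monomial. -/
structure IsAdmissible {σ : Type*} (lt : (σ →₀ ℕ) → (σ →₀ ℕ) → Prop) : Prop where
  strictTotal : IsStrictTotalOrder (σ →₀ ℕ) lt
  add_right : ∀ x y z, lt x y → lt (x + z) (y + z)
  zero_lt : ∀ x, x ≠ 0 → lt 0 x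

/-- `Λ` is a Gröbner system of the congruence `c` on monomials, with respect to `lt`. The
monomial with exponent vector `x` divides the one with exponent vector `z` iff `x ≤ z`. -/
structure IsGroebnerSystem {σ : Type*} (lt : (σ →₀ ℕ) → (σ →₀ ℕ) → Prop)
    (c : AddCon (σ →₀ ℕ)) (Λ : Set ((σ →₀ ℕ) × (σ →₀ ℕ))) : Prop where
  finite : Λ.Finite
  rel_and_lt : ∀ p ∈ Λ, c p.1 p.2 ∧ lt p.2 p.1
  minimal : ∀ z, (¬ ∃ p ∈ Λ, p.1 ≤ z) → ∀ w, c z w → w ≠ z → lt z w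

variable (S : Type*) [AddCommMonoid S]

/-- The set of atoms of the (additively written) monoid `S`. -/
abbrev Atom : Type _ := {a : S // AddIrreducible a}

/-- The factorization homomorphism from the free commutative monoid on the atoms of `S`
to `S`, which sends every atom to itself. -/
def factorization : (Atom S →₀ ℕ) →+ S :=
  Finsupp.liftAddHom fun a : Atom S => multiplesHom S (a : S)

/-- The defining congruence of `S`. -/
def defCon : AddCon (Atom S →₀ ℕ) := AddCon.ker (factorization S)

/-- The defining congruence of `S` has, for some admissible order, a Gröbner system that
consists of pairs of monomials of degree at most two. -/
def HasQuadraticGroebnerSystem : Prop :=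
  ∃ lt : (Atom S →₀ ℕ) → (Atom S →₀ ℕ) → Prop, IsAdmissible lt ∧
    ∃ Λ : Set ((Atom S →₀ ℕ) × (Atom S →₀ ℕ)), IsGroebnerSystem lt (defCon S) Λ ∧
      ∀ p ∈ Λ, p.1.degree ≤ 2 ∧ p.2.degree ≤ 2

/-- The degree `d` part of the semigroup algebra `k[S]` when every atom has degree one: the
span of all products of `d` atoms. -/
def lengthGrading (k : Type*) [Field k] (d : ℕ) : Submodule k (AddMonoidAlgebra k S) :=
  Submodule.span k {f | ∃ α : Atom S →₀ ℕ, α.degree = d ∧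
    f = AddMonoidAlgebra.single (factorization S α) 1}

end Groebner

section Koszul

universe u

/-- A commutative graded algebra `A = ⨁ Aₙ` over a field `k` is Koszul if it is connected
(`A₀ = k`) and the trivial module `A / A₊ = k` has a linear free resolution
`⋯ → A(-2)^{I₂} → A(-1)^{I₁} → A^{I₀} → A / A₊ → 0`: an exact complex of free modules in
which all matrix entries of the differentials `d n : A^{I (n+1)} → A^{I n}` lie in `A₁`. -/
def IsKoszul {k : Type*} {A : Type u} [Field k] [CommRing A] [Algebra k A]
    (𝒜 : ℕ → Submodule k A) [GradedAlgebra 𝒜] : Prop :=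
  Module.finrank k (𝒜 0) = 1 ∧
  ∃ (I : ℕ → Type u)
    (ε : (I 0 →₀ A) →ₗ[A] A ⧸ (HomogeneousIdeal.irrelevant 𝒜).toIdeal)
    (d : ∀ n, (I (n + 1) →₀ A) →ₗ[A] (I n →₀ A)),
    Function.Surjective ε ∧
    Function.Exact (d 0) ε ∧
    (∀ n, Function.Exact (d (n + 1)) (d n)) ∧
    ∀ n i j, d n (Finsupp.single i 1) j ∈ 𝒜 1

end Koszul

end BlockMonoid

end

/-!
The proof has two independent parts. In both, a quadratic Gröbner system is used in the form of
`HasQuadraticReductions`: each monomial which is not minimal in its class is divisible by a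
quadratic monomial that can be replaced by a smaller quadratic one. (Atoms are irreducible, so a
relation between monomials of degree at most two is a relation between monomials of degree two.)
Block monoids have only finitely many atoms, hence admissible orders are well-orders and every
element has a unique normal factorization.

**Gröbner systems.** If `g i = g j` with `i ≠ j`, then `𝓑(g)` consists of the pairs `(s, n)`, where
`s` lies in the block monoid of the family without `g j` and `n ≤ s i`; see `Splitting` and
`splittingOfEq`. The atoms are the pairs `(a, n)` with `a` an atom. Monomials are compared through
their underlying monomials in the atoms `a`, and then by a weight that favours a greedy
distribution of the parts `n`: total parts first, then at most one intermediate part, then parts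
zero, along a fixed enumeration of the atoms. Being greedy is a condition on pairs of atoms, and
two pairs that violate it are improved by moving one unit (`exists_lt_of_not_isFilled`). A greedy
monomial is determined by its class and its underlying monomial (`IsFilled.eq`). Quadratic
reductions thus pass from the smaller family to the larger one, and induction on the size of the
family ends at an injective family, whose monoid is `𝓑(supp g)`.

**Koszulness.** Over `A = k[S]` a linear resolution of `k` in the style of Anick is constructed. The
`n`-th free module has as basis the words `x₁ ⋯ xₙ` in the atoms such that each `xᵢ₊₁` may be
appended to `x₁ ⋯ xᵢ` according to a rule (`Straightening.extend`): the letters `y` that may follow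
`wx` are those with `xy` not normal and those preceding `x` that may follow `w`. The differential
sends `wx` to `x · w` plus smaller terms. If the term `s · wx` is irreducible, that is, no letter of
the normal form of `s` may be appended to `wx`, then `s x` is normal and the leading term `s x · w`
of its image can come from no smaller term. Hence leading terms of cycles are reducible
(`maxTermsReducible_ker`), and a reducible leading term `s y · w` is removed by subtracting the
boundary of `s · wy` (`exists_map_eq`). This yields exactness, and it also allows the next
differential to be constructed (`exists_cycle`). All terms are chosen homogeneous with respect to
the `S`-grading of `A`, so that the differentials have entries of degree one.
-/

open scoped MonomialOrder

namespace BlockMonoid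

/-! ### Admissible orders and quadratic reductions -/

section AdmissibleOrders

variable {σ : Type*}

variable {lt : (σ →₀ ℕ) → (σ →₀ ℕ) → Prop}

lemma IsAdmissible.eq_or_lt_of_le (h : IsAdmissible lt) {x y : σ →₀ ℕ} (hxy : x ≤ y) :
    x = y ∨ lt x y := by
  obtain ⟨z, rfl⟩ := exists_add_of_le hxy
  rcases eq_or_ne z 0 with rfl | hz
  · left; simp
  · right
    have := h.add_right 0 z x (h.zero_lt z hz)
    rwa [zero_add, add_comm] at this

/-- Dickson's lemma makes every admissible order on finitely many variables well-founded. -/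
lemma IsAdmissible.wellFounded [Finite σ] (h : IsAdmissible lt) : WellFounded lt := by
  have := h.strictTotal
  refine wellFounded_iff_isEmpty_descending_chain.2 ⟨fun ⟨f, hf⟩ => ?_⟩
  have anti : ∀ m n, m < n → lt (f n) (f m) := by
    intro m n hmn
    induction n, hmn using Nat.le_induction with
    | base => exact hf m
    | succ n _ ih => exact _root_.trans (hf n) ih
  obtain ⟨m, n, hmn, hle⟩ := wellQuasiOrdered_le f
  have hlt := anti m n hmn
  rcases h.eq_or_lt_of_le hle with he | hl
  · rw [he] at hlt
    exact irrefl _ hlt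
  · exact asymm hl hlt

/-- The exponent vectors, as a type of their own on which an admissible order is the order. -/
def IsAdmissible.Exponents (_ : IsAdmissible lt) : Type _ := σ →₀ ℕ

noncomputable instance (h : IsAdmissible lt) : AddCommMonoid h.Exponents :=
  inferInstanceAs (AddCommMonoid (σ →₀ ℕ))

open Classical in
noncomputable instance (h : IsAdmissible lt) : LinearOrder h.Exponents :=
  @linearOrderOfSTO (σ →₀ ℕ) lt h.strictTotal _

lemma IsAdmissible.exponents_lt_iff (h : IsAdmissible lt) (x y : h.Exponents) :
    x < y ↔ lt x y := Iff.rfl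

instance (h : IsAdmissible lt) : IsOrderedAddMonoid h.Exponents where
  add_le_add_left x y hxy z := by
    rcases hxy.eq_or_lt with rfl | hxy
    · exact le_rfl
    · exact le_of_lt (h.add_right x y z hxy)

instance [Finite σ] (h : IsAdmissible lt) : WellFoundedLT h.Exponents := ⟨h.wellFounded⟩

/-- An admissible order on the monomials in finitely many variables, as a `MonomialOrder`. -/
noncomputable def IsAdmissible.toMonomialOrder [Finite σ] (h : IsAdmissible lt) :
    MonomialOrder σ where
  syn := h.Exponents
  toSyn :=
    { toFun := fun x => x
      invFun := fun x => x
      left_inv := fun _ => rfl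
      right_inv := fun _ => rfl
      map_add' := fun _ _ => rfl }
  toSyn_monotone x y hxy := by
    rcases h.eq_or_lt_of_le hxy with rfl | hlt
    · exact le_rfl
    · exact le_of_lt ((h.exponents_lt_iff x y).2 hlt)

lemma IsAdmissible.toMonomialOrder_lt_iff [Finite σ] (h : IsAdmissible lt)
    (x y : σ →₀ ℕ) : x ≺[h.toMonomialOrder] y ↔ lt x y :=
  Iff.rfl

/-- Every additive embedding of the exponent vectors into an ordered monoid which makes all
nonzero exponent vectors positive defines an admissible order. -/
lemma isAdmissible_of_injective {Γ : Type*} [AddCommMonoid Γ] [LinearOrder Γ]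
    [IsOrderedCancelAddMonoid Γ] (ψ : (σ →₀ ℕ) →+ Γ) (hψ : Function.Injective ψ)
    (hpos : ∀ x, x ≠ 0 → 0 < ψ x) : IsAdmissible fun x y => ψ x < ψ y where
  strictTotal :=
    { trichotomous := fun x y h₁ h₂ => hψ (le_antisymm (not_lt.1 h₂) (not_lt.1 h₁))
      irrefl := fun x => lt_irrefl _
      trans := fun x y z => lt_trans }
  add_right x y z h := by
    rw [map_add, map_add]
    exact add_lt_add_left h _
  zero_lt x hx := by
    rw [map_zero]
    exact hpos x hx

lemma isAdmissible_monomialOrder (m : MonomialOrder σ) : IsAdmissible fun x y => x ≺[m] y :=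
  isAdmissible_of_injective (m.toSyn : (σ →₀ ℕ) →+ m.syn) m.toSyn.injective fun _ hx =>
    (m.toSyn_lt_iff_ne_zero).2 (by simpa using hx)

lemma exists_eq_single_of_degree_eq_one {x : σ →₀ ℕ} (h : x.degree = 1) :
    ∃ a, x = Finsupp.single a 1 := by
  have : x ∈ { d : σ →₀ ℕ | d.degree = 1 } := h
  rw [← Finsupp.range_single_one] at this
  obtain ⟨a, rfl⟩ := this
  exact ⟨a, rfl⟩

lemma exists_eq_single_add_of_degree_eq_succ {x : σ →₀ ℕ} {n : ℕ} (h : x.degree = n + 1) :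
    ∃ a y, x = Finsupp.single a 1 + y ∧ y.degree = n := by
  obtain ⟨a, ha⟩ : ∃ a, x a ≠ 0 := by
    by_contra! h0
    have : x = 0 := Finsupp.ext h0
    simp [this] at h
  obtain ⟨y, rfl⟩ := exists_add_of_le
    (show Finsupp.single a 1 ≤ x from Finsupp.single_le_iff.2 (Nat.one_le_iff_ne_zero.2 ha))
  refine ⟨a, y, rfl, ?_⟩
  rw [map_add, Finsupp.degree_single] at h
  omega

lemma exists_eq_single_add_single_of_degree_eq_two {x : σ →₀ ℕ} (h : x.degree = 2) :
    ∃ a b, x = Finsupp.single a 1 + Finsupp.single b 1 := by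
  obtain ⟨a, y, rfl, hy⟩ := exists_eq_single_add_of_degree_eq_succ h
  obtain ⟨b, rfl⟩ := exists_eq_single_of_degree_eq_one hy
  exact ⟨a, b, rfl⟩

end AdmissibleOrders

section NormalMonomials

variable {S : Type*} [AddCommMonoid S]

@[simp]
lemma factorization_single (a : Atom S) (n : ℕ) :
    factorization S (Finsupp.single a n) = n • (a : S) := by
  simp [factorization]

/-- The monomial `z` is the minimal element of its class with respect to the defining
congruence of `S`. -/
def IsNormal (m : MonomialOrder (Atom S)) (z : Atom S →₀ ℕ) : Prop :=
  ∀ w, factorization S w = factorization S z → z ≼[m] w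

/-- Every monomial which is not minimal in its class is divisible by a quadratic monomial that
the defining congruence identifies with a smaller quadratic monomial. -/
def HasQuadraticReductions (m : MonomialOrder (Atom S)) : Prop :=
  ∀ z, ¬ IsNormal m z → ∃ x y, x ≤ z ∧ factorization S x = factorization S y ∧ y ≺[m] x ∧
    x.degree = 2 ∧ y.degree = 2

lemma not_isNormal_of_lt {m : MonomialOrder (Atom S)} {x y : Atom S →₀ ℕ}
    (h : factorization S y = factorization S x) (hlt : y ≺[m] x) : ¬ IsNormal m x :=
  fun hx => (hx y h).not_gt hlt

lemma IsNormal.eq {m : MonomialOrder (Atom S)} {x y : Atom S →₀ ℕ} (hx : IsNormal m x)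
    (hy : IsNormal m y) (h : factorization S x = factorization S y) : x = y :=
  m.toSyn.injective (le_antisymm (hx y h.symm) (hy x h))

lemma IsNormal.of_add {m : MonomialOrder (Atom S)} {x y : Atom S →₀ ℕ}
    (h : IsNormal m (x + y)) : IsNormal m x := by
  intro w hw
  have := h (w + y) (by rw [map_add, map_add, hw])
  rw [map_add, map_add] at this
  exact le_of_add_le_add_right this

lemma IsNormal.of_le {m : MonomialOrder (Atom S)} {x z : Atom S →₀ ℕ} (h : IsNormal m z)
    (hxz : x ≤ z) : IsNormal m x := by
  obtain ⟨y, rfl⟩ := exists_add_of_le hxz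
  exact h.of_add

lemma exists_isNormal (m : MonomialOrder (Atom S)) (z : Atom S →₀ ℕ) :
    ∃ w, factorization S w = factorization S z ∧ IsNormal m w := by
  obtain ⟨w, hw, hmin⟩ := (InvImage.wf m.toSyn wellFounded_lt).has_min
    {w | factorization S w = factorization S z} ⟨z, rfl⟩
  exact ⟨w, hw, fun v hv => not_lt.1 (hmin v (hv.trans hw))⟩

/-- As atoms are not sums of two nonzero elements, identified monomials of degree at most two
have the same degree, and if they are different then this degree is two. -/
lemma degree_eq_two_of_factorization_eq [Subsingleton (AddUnits S)] {x y : Atom S →₀ ℕ}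
    (h : factorization S x = factorization S y) (hne : x ≠ y) (hx : x.degree ≤ 2)
    (hy : y.degree ≤ 2) : x.degree = 2 := by
  have atom_ne : ∀ a : Atom S, (a : S) ≠ 0 := fun a ha =>
    a.2.not_isAddUnit (isAddUnit_iff_eq_zero.2 ha)
  have atom_ne_add : ∀ a b c : Atom S, (a : S) ≠ b + c := fun a b c habc => by
    rcases a.2.isAddUnit_or_isAddUnit habc with hb | hb <;>
      exact atom_ne _ (isAddUnit_iff_eq_zero.1 hb)
  have cases : ∀ z : Atom S →₀ ℕ, z.degree ≤ 2 → z = 0 ∨ (∃ a, z = Finsupp.single a 1) ∨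
      (z.degree = 2 ∧ ∃ a b, z = Finsupp.single a 1 + Finsupp.single b 1) := by
    intro z hz
    interval_cases hd : z.degree
    · exact Or.inl ((Finsupp.degree_eq_zero_iff z).1 hd)
    · exact Or.inr (Or.inl (exists_eq_single_of_degree_eq_one hd))
    · exact Or.inr (Or.inr ⟨rfl, exists_eq_single_add_single_of_degree_eq_two hd⟩)
  rcases cases x hx with rfl | ⟨a, rfl⟩ | ⟨hx2, -⟩
  · rcases cases y hy with rfl | ⟨c, rfl⟩ | ⟨-, c, d, rfl⟩
    · exact absurd rfl hne
    · exact absurd (by simpa using h.symm) (atom_ne c)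
    · simp only [map_zero, map_add, factorization_single, one_smul] at h
      exact absurd (eq_zero_of_add_right h.symm) (atom_ne c)
  · rcases cases y hy with rfl | ⟨c, rfl⟩ | ⟨-, c, d, rfl⟩
    · exact absurd (by simpa using h) (atom_ne a)
    · simp only [factorization_single, one_smul] at h
      exact absurd (congrArg (Finsupp.single · 1) (Subtype.ext h)) hne
    · simp only [map_add, factorization_single, one_smul] at h
      exact absurd h (atom_ne_add a c d)
  · exact hx2

lemma hasQuadraticGroebnerSystem_iff [Subsingleton (AddUnits S)] [Finite (Atom S)] :
    HasQuadraticGroebnerSystem S ↔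
      ∃ m : MonomialOrder.{_, u_1} (Atom S), HasQuadraticReductions m := by
  constructor
  · rintro ⟨lt, hlt, Λ, hΛ, hdeg⟩
    refine ⟨hlt.toMonomialOrder, fun z hz => ?_⟩
    have hex : ∃ p ∈ Λ, p.1 ≤ z := by
      by_contra hex
      refine hz fun w hw => ?_
      rcases eq_or_ne w z with rfl | hne
      · exact le_rfl
      · exact le_of_lt (hΛ.minimal z hex w hw.symm hne)
    obtain ⟨p, hp, hpz⟩ := hex
    obtain ⟨hc, hl⟩ := hΛ.rel_and_lt p hp
    have hne : p.1 ≠ p.2 := by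
      have := hlt.strictTotal
      intro he
      rw [he] at hl
      exact irrefl _ hl
    exact ⟨p.1, p.2, hpz, hc, hl,
      degree_eq_two_of_factorization_eq hc hne (hdeg p hp).1 (hdeg p hp).2,
      degree_eq_two_of_factorization_eq hc.symm hne.symm (hdeg p hp).2 (hdeg p hp).1⟩
  · rintro ⟨m, hm⟩
    refine ⟨_, isAdmissible_monomialOrder m,
      {p | (p.1.degree ≤ 2 ∧ p.2.degree ≤ 2) ∧ defCon S p.1 p.2 ∧ p.2 ≺[m] p.1},
      ⟨?_, fun p hp => hp.2, ?_⟩, fun p hp => hp.1⟩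
    · exact ((Finsupp.finite_of_degree_le 2).prod (Finsupp.finite_of_degree_le 2)).subset
        fun p hp => hp.1
    · intro z hz w hw hne
      by_contra hlt
      have hnz : ¬ IsNormal m z := fun hn => hlt
        (lt_of_le_of_ne (hn w hw.symm) fun he => hne (m.toSyn.injective he).symm)
      obtain ⟨x, y, hxz, hxy, hlt, hx, hy⟩ := hm z hnz
      exact hz ⟨(x, y), ⟨⟨hx.le, hy.le⟩, hxy, hlt⟩, hxz⟩

/-- With quadratic reductions all monomials in a class have the same degree: a reduction step
replaces a quadratic factor by a smaller quadratic one. -/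
lemma HasQuadraticReductions.degree_eq {m : MonomialOrder (Atom S)}
    (hm : HasQuadraticReductions m) {x y : Atom S →₀ ℕ}
    (h : factorization S x = factorization S y) : x.degree = y.degree := by
  have key : ∀ z : Atom S →₀ ℕ, ∃ w, factorization S w = factorization S z ∧ IsNormal m w ∧
      w.degree = z.degree := by
    intro z
    induction z using (InvImage.wf m.toSyn wellFounded_lt).induction with
    | _ z ih =>
      by_cases hz : IsNormal m z
      · exact ⟨z, rfl, hz, rfl⟩
      obtain ⟨u, v, huz, huv, hlt, hu, hv⟩ := hm z hz
      obtain ⟨t, rfl⟩ := exists_add_of_le huz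
      have hlt' : v + t ≺[m] u + t := by
        rw [map_add, map_add]
        exact add_lt_add_left hlt _
      obtain ⟨w, hw, hnw, hdw⟩ := ih (v + t) hlt'
      refine ⟨w, ?_, hnw, ?_⟩
      · rw [hw, map_add, map_add, huv]
      · rw [hdw, map_add, map_add, hu, hv]
  obtain ⟨u, hu, hnu, hdu⟩ := key x
  obtain ⟨v, hv, hnv, hdv⟩ := key y
  rw [← hdu, ← hdv, hnu.eq hnv (by rw [hu, hv, h])]

end NormalMonomials

/-! ### Splitting a coordinate -/

noncomputable section SplittingCoordinate

universe u w

variable {S T : Type*} [AddCommMonoid S] [AddCommMonoid T]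

/-- `T` arises from `S` by splitting the coordinate `total` into two: it consists of the pairs
`(s, n)` with `s : S` and `n ≤ total s`. -/
structure Splitting (T S : Type*) [AddCommMonoid T] [AddCommMonoid S] where
  /-- The first component of a pair. -/
  base : T →+ S
  /-- The second component of a pair. -/
  part : T →+ ℕ
  /-- The coordinate of `S` which is split. -/
  total : S →+ ℕ
  part_le : ∀ t, part t ≤ total (base t)
  ext : ∀ t t', base t = base t' → part t = part t' → t = t'
  exists_of_le : ∀ s n, n ≤ total s → ∃ t, base t = s ∧ part t = n

namespace Splitting

variable (φ : Splitting T S)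

lemma eq_zero_of_base_eq_zero {t : T} (h : φ.base t = 0) : t = 0 := by
  refine φ.ext _ _ (by rw [h, map_zero]) ?_
  have := φ.part_le t
  rw [h, map_zero] at this
  rw [map_zero]
  omega

/-- An element can be decomposed like its first component. -/
lemma exists_add_eq {t : T} {a b : S} (h : φ.base t = a + b) :
    ∃ u v, t = u + v ∧ φ.base u = a ∧ φ.base v = b := by
  have hle := φ.part_le t
  rw [h, map_add] at hle
  obtain ⟨u, hu, hu'⟩ := φ.exists_of_le a (min (φ.part t) (φ.total a)) (min_le_right _ _)
  obtain ⟨v, hv, hv'⟩ := φ.exists_of_le b (φ.part t - min (φ.part t) (φ.total a)) (by omega)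
  refine ⟨u, v, φ.ext _ _ ?_ ?_, hu, hv⟩
  · rw [map_add, hu, hv, h]
  · rw [map_add, hu', hv']
    omega

variable [Subsingleton (AddUnits S)] [Subsingleton (AddUnits T)]

lemma addIrreducible_iff (t : T) : AddIrreducible t ↔ AddIrreducible (φ.base t) := by
  simp only [_root_.addIrreducible_iff, isAddUnit_iff_eq_zero]
  constructor
  · rintro ⟨h₀, h⟩
    refine ⟨fun h' => h₀ (φ.eq_zero_of_base_eq_zero h'), fun a b hab => ?_⟩
    obtain ⟨u, v, huv, rfl, rfl⟩ := φ.exists_add_eq hab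
    exact (h huv).imp (fun h => by rw [h, map_zero]) (fun h => by rw [h, map_zero])
  · rintro ⟨h₀, h⟩
    refine ⟨fun h' => h₀ (by rw [h', map_zero]), fun a b hab => ?_⟩
    exact (h (by rw [hab, map_add])).imp φ.eq_zero_of_base_eq_zero φ.eq_zero_of_base_eq_zero

/-- The atom of `S` underlying an atom of `T`. -/
def baseAtom (x : Atom T) : Atom S := ⟨φ.base x, (φ.addIrreducible_iff _).1 x.2⟩

lemma exists_atom (a : Atom S) (n : ℕ) (hn : n ≤ φ.total a) :
    ∃ x : Atom T, φ.baseAtom x = a ∧ φ.part x = n := by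
  obtain ⟨t, ht, ht'⟩ := φ.exists_of_le a n hn
  refine ⟨⟨t, (φ.addIrreducible_iff _).2 ?_⟩, Subtype.ext ht, ht'⟩
  rw [ht]
  exact a.2

lemma atom_ext {x y : Atom T} (h : φ.baseAtom x = φ.baseAtom y) (h' : φ.part x = φ.part y) :
    x = y :=
  Subtype.ext (φ.ext _ _ (congrArg Subtype.val h) h')

lemma part_le_total (x : Atom T) : φ.part x ≤ φ.total (φ.baseAtom x) := φ.part_le x

/-- Replace every atom of `T` in a monomial by the underlying atom of `S`. -/
def push : (Atom T →₀ ℕ) →+ (Atom S →₀ ℕ) := Finsupp.mapDomain.addMonoidHom φ.baseAtom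

@[simp]
lemma push_single (x : Atom T) (n : ℕ) :
    φ.push (Finsupp.single x n) = Finsupp.single (φ.baseAtom x) n :=
  Finsupp.mapDomain_single

lemma degree_push (z : Atom T →₀ ℕ) : (φ.push z).degree = z.degree :=
  Finsupp.degree_mapDomain _ _

lemma factorization_push (z : Atom T →₀ ℕ) :
    factorization S (φ.push z) = φ.base (factorization T z) := by
  induction z using Finsupp.induction_linear with
  | zero => simp
  | add x y hx hy => rw [map_add, map_add, map_add, map_add, hx, hy]
  | single x n =>
    rw [push_single, factorization_single, factorization_single, map_nsmul]
    rfl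

lemma exists_single_le_of_push {z : Atom T →₀ ℕ} {a : Atom S} {v : Atom S →₀ ℕ}
    (h : Finsupp.single a 1 + v ≤ φ.push z) :
    ∃ x z', z = Finsupp.single x 1 + z' ∧ φ.baseAtom x = a ∧ v ≤ φ.push z' := by
  classical
  have ha : a ∈ (φ.push z).support := by
    rw [Finsupp.mem_support_iff]
    have := h a
    rw [Finsupp.add_apply, Finsupp.single_eq_same] at this
    omega
  obtain ⟨x, hx, rfl⟩ := Finset.mem_image.1 (Finsupp.mapDomain_support ha)
  obtain ⟨z', rfl⟩ := exists_add_of_le (show Finsupp.single x 1 ≤ z from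
    Finsupp.single_le_iff.2 (Nat.one_le_iff_ne_zero.2 (Finsupp.mem_support_iff.1 hx)))
  refine ⟨x, z', rfl, rfl, ?_⟩
  rwa [map_add, push_single, add_le_add_iff_left] at h

/-- The monomial `z` fills the split coordinate greedily, along the enumeration `idx` of the atoms
of `S`: an atom of `T` has a nonzero part only if the parts of all earlier atoms are total, and
of two atoms over the same atom of `S` one has part zero or total part. -/
def IsFilled (idx : Atom S → ℕ) (z : Atom T →₀ ℕ) : Prop :=
  ∀ x y, Finsupp.single x 1 + Finsupp.single y 1 ≤ z →
    (idx (φ.baseAtom x) < idx (φ.baseAtom y) →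
      φ.part x = φ.total (φ.baseAtom x) ∨ φ.part y = 0) ∧
    (φ.baseAtom x = φ.baseAtom y → φ.part x ≤ φ.part y →
      φ.part x = 0 ∨ φ.part y = φ.total (φ.baseAtom y))

variable {φ} in
lemma IsFilled.of_le {idx : Atom S → ℕ} {z z' : Atom T →₀ ℕ} (h : φ.IsFilled idx z)
    (hle : z' ≤ z) : φ.IsFilled idx z' := fun x y hxy => h x y (hxy.trans hle)

/-- A filled monomial contains an atom over the first atom of `S` that occurs, with as large a
part as the monomial allows. -/
lemma exists_mem_support_of_isFilled {idx : Atom S → ℕ} (hidx : Function.Injective idx)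
    {z : Atom T →₀ ℕ} (h : φ.IsFilled idx z) {a : Atom S} (ha : a ∈ (φ.push z).support)
    (hmin : ∀ b ∈ (φ.push z).support, idx a ≤ idx b) :
    ∃ x ∈ z.support, φ.baseAtom x = a ∧
      φ.part x = min (φ.part (factorization T z)) (φ.total a) := by
  classical
  have hne : (z.support.filter fun x => φ.baseAtom x = a).Nonempty := by
    obtain ⟨x, hx, hxa⟩ := Finset.mem_image.1 (Finsupp.mapDomain_support ha)
    exact ⟨x, Finset.mem_filter.2 ⟨hx, hxa⟩⟩
  obtain ⟨x, hx, hmax⟩ := Finset.exists_max_image _ (fun x : Atom T => φ.part x) hne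
  obtain ⟨hxz, rfl⟩ := Finset.mem_filter.1 hx
  refine ⟨x, hxz, rfl, ?_⟩
  obtain ⟨z', rfl⟩ := exists_add_of_le (show Finsupp.single x 1 ≤ z from
    Finsupp.single_le_iff.2 (Nat.one_le_iff_ne_zero.2 (Finsupp.mem_support_iff.1 hxz)))
  have hpart : φ.part (factorization T (Finsupp.single x 1 + z')) =
      φ.part x + φ.part (factorization T z') := by
    rw [map_add, map_add, factorization_single, one_smul]
  rw [hpart]
  rcases (φ.part_le_total x).eq_or_lt with heq | hlt
  · omega
  · -- If the part of `x` is not total, then all other parts vanish.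
    suffices φ.part (factorization T z') = 0 by omega
    have hz' : ∀ y ∈ z'.support, φ.part y = 0 := by
      intro y hy
      have hle : Finsupp.single x 1 + Finsupp.single y 1 ≤ Finsupp.single x 1 + z' := by
        rw [add_le_add_iff_left, Finsupp.single_le_iff]
        exact Nat.one_le_iff_ne_zero.2 (Finsupp.mem_support_iff.1 hy)
      have hyz : y ∈ (Finsupp.single x 1 + z').support := by
        rw [Finsupp.mem_support_iff, Finsupp.add_apply]
        rw [Finsupp.mem_support_iff] at hy
        omega
      have hyp : φ.baseAtom y ∈ (φ.push (Finsupp.single x 1 + z')).support := by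
        obtain ⟨z'', hz''⟩ := exists_add_of_le (show Finsupp.single y 1 ≤
          Finsupp.single x 1 + z' from Finsupp.single_le_iff.2
            (Nat.one_le_iff_ne_zero.2 (Finsupp.mem_support_iff.1 hyz)))
        rw [hz'', map_add, push_single, Finsupp.mem_support_iff, Finsupp.add_apply,
          Finsupp.single_eq_same]
        omega
      rcases (hmin _ hyp).lt_or_eq with hlt' | heq'
      · exact ((h x y hle).1 hlt').resolve_left hlt.ne
      · have hb := hidx heq'
        have hyx := hmax y (Finset.mem_filter.2 ⟨hyz, hb.symm⟩)
        rw [add_comm (Finsupp.single x 1)] at hle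
        exact ((h y x hle).2 hb.symm hyx).resolve_right hlt.ne
    have : φ.part (factorization T z') = ∑ y ∈ z'.support, z' y • φ.part y := by
      simp only [factorization, Finsupp.liftAddHom_apply, Finsupp.sum, map_sum,
        multiplesHom_apply, map_nsmul]
    rw [this]
    exact Finset.sum_eq_zero fun y hy => by rw [hz' y hy, smul_zero]

/-- A filled monomial is determined by its class and the underlying monomial over `S`. -/
lemma IsFilled.eq {idx : Atom S → ℕ} (hidx : Function.Injective idx) :
    ∀ (n : ℕ) {z w : Atom T →₀ ℕ}, z.degree = n → φ.IsFilled idx z → φ.IsFilled idx w →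
      φ.push z = φ.push w → φ.part (factorization T z) = φ.part (factorization T w) → z = w
  | 0, z, w, hn, _, _, hpush, _ => by
    have hw : w.degree = 0 := by rw [← φ.degree_push, ← hpush, φ.degree_push, hn]
    rw [(Finsupp.degree_eq_zero_iff z).1 hn, (Finsupp.degree_eq_zero_iff w).1 hw]
  | n + 1, z, w, hn, hz, hw, hpush, hpart => by
    have hne : (φ.push z).support.Nonempty := by
      rw [Finsupp.support_nonempty_iff]
      intro h0
      have := φ.degree_push z
      rw [h0, map_zero] at this
      omega
    obtain ⟨a, ha, hmin⟩ := Finset.exists_min_image _ idx hne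
    obtain ⟨x, hx, hxa, hxp⟩ := φ.exists_mem_support_of_isFilled hidx hz ha hmin
    rw [hpush] at ha hmin
    obtain ⟨y, hy, hya, hyp⟩ := φ.exists_mem_support_of_isFilled hidx hw ha hmin
    obtain rfl : x = y := φ.atom_ext (hxa.trans hya.symm) (by rw [hxp, hyp, hpart])
    obtain ⟨z', rfl⟩ := exists_add_of_le (show Finsupp.single x 1 ≤ z from
      Finsupp.single_le_iff.2 (Nat.one_le_iff_ne_zero.2 (Finsupp.mem_support_iff.1 hx)))
    obtain ⟨w', rfl⟩ := exists_add_of_le (show Finsupp.single x 1 ≤ w from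
      Finsupp.single_le_iff.2 (Nat.one_le_iff_ne_zero.2 (Finsupp.mem_support_iff.1 hy)))
    rw [map_add, Finsupp.degree_single] at hn
    rw [map_add, map_add, add_right_inj] at hpush
    rw [map_add, map_add, map_add, map_add, add_right_inj] at hpart
    rw [IsFilled.eq hidx n (by omega) (hz.of_le le_add_self) (hw.of_le le_add_self) hpush hpart]

/-- A weight on monomials which decreases when a monomial gets closer to being filled. The bound
`K` on the parts makes it advantageous to move a unit to an earlier atom, and the quadratic
term makes it advantageous to move a unit from a smaller to a larger part. -/
def fillWeight (idx : Atom S → ℕ) (K : ℕ) : (Atom T →₀ ℕ) →+ ℤ :=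
  Finsupp.liftAddHom fun x : Atom T =>
    multiplesHom ℤ (2 * K * idx (φ.baseAtom x) * φ.part x - (φ.part x : ℤ) ^ 2)

lemma fillWeight_single (idx : Atom S → ℕ) (K : ℕ) (x : Atom T) :
    φ.fillWeight idx K (Finsupp.single x 1) =
      2 * K * idx (φ.baseAtom x) * φ.part x - (φ.part x : ℤ) ^ 2 := by
  simp [fillWeight]

/-- Monomials over `T` are compared by means of the underlying monomials over `S`, then by means
of their weights; ties are broken by an arbitrary monomial order. -/
def orderEmbedding (idx : Atom S → ℕ) (K : ℕ) (m : MonomialOrder (Atom S))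
    (m' : MonomialOrder (Atom T)) : (Atom T →₀ ℕ) →+ m.syn ×ₗ (ℤ ×ₗ m'.syn) where
  toFun z := toLex (m.toSyn (φ.push z), toLex (φ.fillWeight idx K z, m'.toSyn z))
  map_zero' := by
    rw [map_zero, map_zero, map_zero, map_zero]
    rfl
  map_add' x y := by
    rw [map_add, map_add, map_add, map_add]
    rfl

lemma isAdmissible (idx : Atom S → ℕ) (K : ℕ) (m : MonomialOrder (Atom S))
    (m' : MonomialOrder (Atom T)) :
    IsAdmissible fun x y => φ.orderEmbedding idx K m m' x < φ.orderEmbedding idx K m m' y := by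
  refine isAdmissible_of_injective _ (fun x y h => ?_) fun x hx => ?_
  · have h₁ := congrArg Prod.snd (toLex.injective h)
    exact m'.toSyn.injective (congrArg Prod.snd (toLex.injective h₁))
  · refine Prod.Lex.toLex_lt_toLex.2 (Or.inl ?_)
    change 0 < m.toSyn (φ.push x)
    rw [m.toSyn_lt_iff_ne_zero]
    intro h0
    have h1 : φ.push x = 0 := by simpa using h0
    have := φ.degree_push x
    rw [h1, map_zero, eq_comm, Finsupp.degree_eq_zero_iff] at this
    exact hx this

lemma orderEmbedding_lt_iff {idx : Atom S → ℕ} {K : ℕ} {m : MonomialOrder (Atom S)}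
    {m' : MonomialOrder (Atom T)} {x y : Atom T →₀ ℕ} :
    φ.orderEmbedding idx K m m' x < φ.orderEmbedding idx K m m' y ↔
      φ.push x ≺[m] φ.push y ∨ φ.push x = φ.push y ∧
        (φ.fillWeight idx K x < φ.fillWeight idx K y ∨
          φ.fillWeight idx K x = φ.fillWeight idx K y ∧ x ≺[m'] y) := by
  refine Prod.Lex.toLex_lt_toLex.trans (or_congr Iff.rfl (and_congr ?_ Prod.Lex.toLex_lt_toLex))
  exact m.toSyn.injective.eq_iff

lemma exists_monomialOrder (σ : Type w) [Finite σ] : Nonempty (MonomialOrder.{w, w} σ) := by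
  obtain ⟨n, ⟨e⟩⟩ := Finite.exists_equiv_fin σ
  let _ : LinearOrder σ := LinearOrder.lift' e e.injective
  exact ⟨MonomialOrder.lex⟩

/-- If a monomial is not filled, then it can be improved by moving one unit between the parts of
two of its atoms. -/
lemma exists_lt_of_not_isFilled {idx : Atom S → ℕ} {K : ℕ} (hK : ∀ a : Atom S, φ.total a ≤ K)
    {z : Atom T →₀ ℕ} (hz : ¬ φ.IsFilled idx z) :
    ∃ u v, u ≤ z ∧ factorization T u = factorization T v ∧ φ.push v = φ.push u ∧
      φ.fillWeight idx K v < φ.fillWeight idx K u ∧ u.degree = 2 ∧ v.degree = 2 := by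
  have exchange : ∀ x y x' y' : Atom T, Finsupp.single x 1 + Finsupp.single y 1 ≤ z →
      φ.baseAtom x' = φ.baseAtom x → φ.baseAtom y' = φ.baseAtom y →
      φ.part x' + φ.part y' = φ.part x + φ.part y →
      φ.fillWeight idx K (Finsupp.single x' 1 + Finsupp.single y' 1) <
        φ.fillWeight idx K (Finsupp.single x 1 + Finsupp.single y 1) →
      ∃ u v, u ≤ z ∧ factorization T u = factorization T v ∧ φ.push v = φ.push u ∧
        φ.fillWeight idx K v < φ.fillWeight idx K u ∧ u.degree = 2 ∧ v.degree = 2 := by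
    intro x y x' y' hle hx hy hp hlt
    have hpush : φ.push (Finsupp.single x' 1 + Finsupp.single y' 1) =
        φ.push (Finsupp.single x 1 + Finsupp.single y 1) := by
      rw [map_add, map_add, push_single, push_single, push_single, push_single, hx, hy]
    refine ⟨_, _, hle, φ.ext _ _ ?_ ?_, hpush, hlt, ?_, ?_⟩
    · rw [← factorization_push, ← factorization_push, hpush]
    · simp only [map_add, factorization_single, one_smul]
      omega
    · simp
    · simp
  unfold IsFilled at hz
  push Not at hz
  obtain ⟨x, y, hle, hxy⟩ := hz
  by_cases h : idx (φ.baseAtom x) < idx (φ.baseAtom y) ∧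
      φ.part x ≠ φ.total (φ.baseAtom x) ∧ φ.part y ≠ 0
  · obtain ⟨hlt, hx, hy⟩ := h
    have hx' := φ.part_le_total x
    have hy' := φ.part_le_total y
    obtain ⟨x', hbx, hpx⟩ := φ.exists_atom (φ.baseAtom x) (φ.part x + 1) (by omega)
    obtain ⟨y', hby, hpy⟩ := φ.exists_atom (φ.baseAtom y) (φ.part y - 1) (by omega)
    refine exchange x y x' y' hle hbx hby (by omega) ?_
    rw [map_add, map_add, fillWeight_single, fillWeight_single, fillWeight_single,
      fillWeight_single, hbx, hby, hpx, hpy, Nat.cast_sub (by omega)]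
    push_cast
    have hyK : (φ.part y : ℤ) ≤ K := by exact_mod_cast hy'.trans (hK _)
    have hKi : (K : ℤ) * (idx (φ.baseAtom x) + 1) ≤ K * idx (φ.baseAtom y) :=
      mul_le_mul_of_nonneg_left (by exact_mod_cast hlt) (by positivity)
    have hx0 : (0 : ℤ) ≤ φ.part x := by positivity
    linarith
  · have h' := hxy (fun h₁ => by tauto)
    obtain ⟨hb, hle', hx, hy⟩ := h'
    have hy' := φ.part_le_total y
    obtain ⟨x', hbx, hpx⟩ := φ.exists_atom (φ.baseAtom x) (φ.part x - 1)
      (by have := φ.part_le_total x; omega)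
    obtain ⟨y', hby, hpy⟩ := φ.exists_atom (φ.baseAtom y) (φ.part y + 1) (by omega)
    refine exchange x y x' y' hle hbx hby (by omega) ?_
    rw [map_add, map_add, fillWeight_single, fillWeight_single, fillWeight_single,
      fillWeight_single, hbx, hby, hpx, hpy, Nat.cast_sub (by omega), hb]
    push_cast
    have : (φ.part x : ℤ) ≤ φ.part y := by exact_mod_cast hle'
    linarith

/-- Splitting a coordinate preserves quadratic Gröbner systems. -/
theorem hasQuadraticGroebnerSystem (φ : Splitting T S) [Finite (Atom S)] [Finite (Atom T)]
    (hS : HasQuadraticGroebnerSystem S) : HasQuadraticGroebnerSystem T := by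
  rw [hasQuadraticGroebnerSystem_iff] at hS ⊢
  obtain ⟨m, hm⟩ := hS
  obtain ⟨N, ⟨e⟩⟩ := Finite.exists_equiv_fin (Atom S)
  let idx : Atom S → ℕ := fun a => e a
  have hidx : Function.Injective idx := fun a b h => e.injective (Fin.ext h)
  obtain ⟨K, hK⟩ : ∃ K, ∀ a : Atom S, φ.total a ≤ K := by
    obtain ⟨K, hK⟩ := (Set.finite_range fun a : Atom S => φ.total a).bddAbove
    exact ⟨K, fun a => hK ⟨a, rfl⟩⟩
  obtain ⟨m'⟩ := exists_monomialOrder (Atom T)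
  have hadm := φ.isAdmissible idx K m m'
  have hlt : ∀ x y : Atom T →₀ ℕ, x ≺[hadm.toMonomialOrder] y ↔ φ.push x ≺[m] φ.push y ∨
      φ.push x = φ.push y ∧ (φ.fillWeight idx K x < φ.fillWeight idx K y ∨
        φ.fillWeight idx K x = φ.fillWeight idx K y ∧ x ≺[m'] y) := fun x y =>
    (hadm.toMonomialOrder_lt_iff x y).trans φ.orderEmbedding_lt_iff
  refine ⟨hadm.toMonomialOrder, fun z hz => ?_⟩
  have filling : ∀ w, ¬ φ.IsFilled idx w → ∃ u v, u ≤ w ∧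
      factorization T u = factorization T v ∧ v ≺[hadm.toMonomialOrder] u ∧
      u.degree = 2 ∧ v.degree = 2 := by
    intro w hw
    obtain ⟨u, v, huw, huv, hpush, hwt, hu, hv⟩ := φ.exists_lt_of_not_isFilled hK hw
    exact ⟨u, v, huw, huv, (hlt _ _).2 (Or.inr ⟨hpush, Or.inl hwt⟩), hu, hv⟩
  by_cases hpush : IsNormal m (φ.push z)
  · refine filling z fun hfill => hz ?_
    obtain ⟨w, hwz, hw⟩ := exists_isNormal hadm.toMonomialOrder z
    suffices z = w by rwa [this]
    have hwfill : φ.IsFilled idx w := by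
      by_contra hwfill
      obtain ⟨u, v, huw, huv, hlt', -, -⟩ := filling w hwfill
      exact not_isNormal_of_lt huv.symm hlt' (hw.of_le huw)
    have hle : φ.push z ≼[m] φ.push w := hpush _ (by
      rw [factorization_push, factorization_push, hwz])
    have hge : ¬ φ.push z ≺[m] φ.push w := fun h => (hw z hwz.symm).not_gt ((hlt z w).2 (Or.inl h))
    exact IsFilled.eq φ hidx _ rfl hfill hwfill
      (m.toSyn.injective (hle.eq_or_lt.resolve_right hge)) (by rw [hwz])
  · -- A reduction over `S` lifts, since the parts can be distributed over the new atoms.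
    obtain ⟨u, v, huz, huv, hvu, hu, hv⟩ := hm _ hpush
    obtain ⟨a, b, rfl⟩ := exists_eq_single_add_single_of_degree_eq_two hu
    obtain ⟨c, d, rfl⟩ := exists_eq_single_add_single_of_degree_eq_two hv
    obtain ⟨x, z', rfl, rfl, hz'⟩ := φ.exists_single_le_of_push huz
    rw [← add_zero (Finsupp.single b 1)] at hz'
    obtain ⟨y, z'', rfl, rfl, -⟩ := φ.exists_single_le_of_push hz'
    simp only [map_add, factorization_single, one_smul] at huv
    have htotal := congrArg φ.total huv
    rw [map_add, map_add] at htotal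
    have hx := φ.part_le_total x
    have hy := φ.part_le_total y
    obtain ⟨x', hbx, hpx⟩ := φ.exists_atom c (min (φ.part x + φ.part y) (φ.total c))
      (min_le_right _ _)
    obtain ⟨y', hby, hpy⟩ := φ.exists_atom d
      (φ.part x + φ.part y - min (φ.part x + φ.part y) (φ.total c)) (by omega)
    refine ⟨Finsupp.single x 1 + Finsupp.single y 1, Finsupp.single x' 1 + Finsupp.single y' 1,
      ?_, φ.ext _ _ ?_ ?_, (hlt _ _).2 (Or.inl ?_), by simp, by simp⟩
    · rw [← add_assoc]
      exact le_self_add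
    · rw [← factorization_push, ← factorization_push]
      simp only [map_add, push_single, factorization_single, one_smul, hbx, hby, huv]
    · simp only [map_add, factorization_single, one_smul, hpx, hpy]
      omega
    · simpa only [map_add, push_single, hbx, hby] using hvu

end Splitting

end SplittingCoordinate

/-! ### Free modules over a semigroup algebra -/

noncomputable section TermSupport

variable {k S I J : Type*} [Field k] [AddCommMonoid S]

/-- The elements `f` of the free `k[S]`-module on `I` all of whose terms `(i, s)`, that is the
pairs such that `s` occurs in the `i`-th coordinate of `f`, satisfy the relation `R`. -/
def termsIn (k : Type*) [Field k] (R : I → S → Prop) :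
    Submodule k (I →₀ AddMonoidAlgebra k S) where
  carrier := {f | ∀ i s, (f i).coeff s ≠ 0 → R i s}
  zero_mem' := by
    intro i s h
    simp at h
  add_mem' := by
    intro f g hf hg i s h
    by_cases h₁ : (f i).coeff s = 0
    · refine hg i s fun h₂ => h ?_
      simp [h₁, h₂]
    · exact hf i s h₁
  smul_mem' := by
    intro c f hf i s h
    refine hf i s fun h₁ => h ?_
    simp [h₁]

lemma termsIn_mono {R R' : I → S → Prop} (h : ∀ i s, R i s → R' i s) :
    termsIn k R ≤ termsIn k R' := fun _ hf i s hs => h i s (hf i s hs)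

/-- The basis element with the single term `(i, s)`. -/
def term (k : Type*) [Field k] (i : I) (s : S) : I →₀ AddMonoidAlgebra k S :=
  Finsupp.single i (AddMonoidAlgebra.single s 1)

lemma coeff_term_self (i : I) (s : S) : (term k i s i).coeff s = 1 := by
  simp [term]

lemma coeff_term_of_ne {i i' : I} {s s' : S} (h : ¬ (i' = i ∧ s' = s)) :
    (term k i s i').coeff s' = 0 := by
  classical
  rw [term, Finsupp.single_apply]
  split_ifs with hi
  · rw [AddMonoidAlgebra.coeff_single, Finsupp.single_apply, if_neg]
    rintro rfl
    exact h ⟨hi.symm, rfl⟩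
  · rfl

lemma term_mem_termsIn {R : I → S → Prop} {i : I} {s : S} (h : R i s) :
    term k i s ∈ termsIn k R := by
  intro i' s' hne
  by_cases h' : i' = i ∧ s' = s
  · rwa [h'.1, h'.2]
  · exact absurd (coeff_term_of_ne h') hne

lemma eq_sum_term (f : I →₀ AddMonoidAlgebra k S) :
    f = ∑ i ∈ f.support, ∑ s ∈ (f i).coeff.support, (f i).coeff s • term k i s := by
  conv_lhs => rw [← Finsupp.sum_single f]
  refine Finset.sum_congr rfl fun i _ => ?_
  conv_lhs => rw [← AddMonoidAlgebra.sum_coeff_single (f i)]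
  rw [Finsupp.sum, Finsupp.single_finsetSum]
  refine Finset.sum_congr rfl fun s _ => ?_
  rw [term, Finsupp.smul_single, AddMonoidAlgebra.smul_single, smul_eq_mul, mul_one]

lemma termsIn_le {R : I → S → Prop} {U : Submodule k (I →₀ AddMonoidAlgebra k S)}
    (h : ∀ i s, R i s → term k i s ∈ U) : termsIn k R ≤ U := by
  intro f hf
  rw [eq_sum_term f]
  refine Submodule.sum_mem _ fun i _ => Submodule.sum_mem _ fun s hs => Submodule.smul_mem _ _ ?_
  exact h i s (hf i s (Finsupp.mem_support_iff.1 hs))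

lemma smul_mem_termsIn {R R' : I → S → Prop} {s : S} (h : ∀ i t, R i t → R' i (s + t))
    {f : I →₀ AddMonoidAlgebra k S} (hf : f ∈ termsIn k R) :
    (AddMonoidAlgebra.single s (1 : k)) • f ∈ termsIn k R' := by
  have key : termsIn k R ≤ (termsIn k R').comap
      ((LinearMap.lsmul (AddMonoidAlgebra k S) (I →₀ AddMonoidAlgebra k S)
        (AddMonoidAlgebra.single s 1)).restrictScalars k) := by
    refine termsIn_le fun i t hit => ?_
    have : term k i (s + t) ∈ termsIn k R' := term_mem_termsIn (h i t hit)
    simpa [term, AddMonoidAlgebra.single_mul_single] using this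
  exact key hf

lemma map_mem_of_termsIn {R : I → S → Prop}
    (d : (I →₀ AddMonoidAlgebra k S) →ₗ[AddMonoidAlgebra k S] (J →₀ AddMonoidAlgebra k S))
    {U : Submodule k (J →₀ AddMonoidAlgebra k S)} (h : ∀ i s, R i s → d (term k i s) ∈ U)
    {f : I →₀ AddMonoidAlgebra k S} (hf : f ∈ termsIn k R) : d f ∈ U := by
  have key : termsIn k R ≤ U.comap (d.restrictScalars k) := termsIn_le h
  exact key hf

/-- A nonzero element has a term at which a given key takes its largest value. -/
lemma exists_max_term {Γ : Type*} [LinearOrder Γ] (key : I → S → Γ)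
    {f : I →₀ AddMonoidAlgebra k S} (hf : f ≠ 0) :
    ∃ i s, (f i).coeff s ≠ 0 ∧ ∀ i' s', (f i').coeff s' ≠ 0 → key i' s' ≤ key i s := by
  classical
  let A : Finset (Σ _ : I, S) := f.support.sigma fun i => (f i).coeff.support
  have hA : ∀ i s, (f i).coeff s ≠ 0 → (⟨i, s⟩ : Σ _ : I, S) ∈ A := by
    intro i s h
    refine Finset.mem_sigma.2 ⟨Finsupp.mem_support_iff.2 fun h0 => h ?_,
      Finsupp.mem_support_iff.2 h⟩
    rw [h0]; rfl
  have hne : A.Nonempty := by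
    by_contra hA'
    rw [Finset.not_nonempty_iff_eq_empty] at hA'
    refine hf (Finsupp.ext fun i => AddMonoidAlgebra.coeff_injective (Finsupp.ext fun s => ?_))
    by_contra h
    have := hA i s h
    rw [hA'] at this
    simp at this
  obtain ⟨⟨i, s⟩, hmem, hmax⟩ := A.exists_max_image (fun p => key p.1 p.2) hne
  exact ⟨i, s, Finsupp.mem_support_iff.1 (Finset.mem_sigma.1 hmem).2,
    fun i' s' h => hmax ⟨i', s'⟩ (hA i' s' h)⟩

end TermSupport

/-! ### Words in the atoms -/

noncomputable section Words

universe u v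

/-- A monoid with quadratic reductions, together with a choice of normal forms and an
enumeration of its atoms. -/
structure Straightening (S : Type u) [AddCommMonoid S] where
  /-- The order on the monomials in the atoms. -/
  order : MonomialOrder.{u, v} (Atom S)
  reductions : HasQuadraticReductions order
  /-- The minimal factorization of an element into atoms. -/
  nf : S → Atom S →₀ ℕ
  factorization_nf : ∀ s, factorization S (nf s) = s
  isNormal_nf : ∀ s, IsNormal order (nf s)
  /-- The enumeration of the atoms. -/
  rank : Atom S → ℕ
  rank_injective : Function.Injective rank
  /-- A strict upper bound for the ranks of the atoms. -/
  bound : ℕ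
  rank_lt : ∀ a, rank a < bound

/-- A family of words in the atoms of `S`: a set `I` of words, which are compared by means of
their ranks and have monomials as weights, and for every word the set of letters by which it may
be extended. -/
structure WordFamily (S : Type u) [AddCommMonoid S] where
  /-- The words. -/
  I : Type u
  /-- The rank of a word. -/
  rank : I → ℕ
  rank_injective : Function.Injective rank
  /-- The product of the letters of a word. -/
  weight : I → Atom S →₀ ℕ
  /-- The letters that may be appended to a word. -/
  letters : I → Set (Atom S)

namespace Straightening

variable {S : Type u} [AddCommMonoid S] (Q : Straightening.{u, v} S)

lemma nf_factorization {z : Atom S →₀ ℕ} (hz : IsNormal Q.order z) :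
    Q.nf (factorization S z) = z :=
  (Q.isNormal_nf _).eq hz (Q.factorization_nf _)

lemma nf_factorization_le (z : Atom S →₀ ℕ) : Q.nf (factorization S z) ≼[Q.order] z :=
  Q.isNormal_nf _ _ (Q.factorization_nf _).symm

lemma nf_add_le (s t : S) : Q.nf (s + t) ≼[Q.order] Q.nf s + Q.nf t := by
  have := Q.nf_factorization_le (Q.nf s + Q.nf t)
  rwa [map_add, Q.factorization_nf, Q.factorization_nf] at this

lemma isNormal_of_degree_le_one {z : Atom S →₀ ℕ} (hz : z.degree ≤ 1) :
    IsNormal Q.order z := by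
  by_contra h
  obtain ⟨x, -, hxz, -, -, hx, -⟩ := Q.reductions z h
  have := Finsupp.degree_mono hxz
  omega

lemma nf_atom (a : Atom S) : Q.nf a = Finsupp.single a 1 := by
  have := Q.nf_factorization (Q.isNormal_of_degree_le_one (Finsupp.degree_single a 1).le)
  rwa [factorization_single, one_smul] at this

lemma nf_zero : Q.nf 0 = 0 := by
  have := Q.nf_factorization (Q.isNormal_of_degree_le_one (z := 0) (by simp))
  rwa [map_zero] at this

/-- The empty word. It may be extended by every letter. -/
def emptyWord (S : Type u) [AddCommMonoid S] : WordFamily S where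
  I := PUnit
  rank _ := 0
  rank_injective _ _ _ := rfl
  weight _ := 0
  letters _ := Set.univ

/-- The words obtained by appending an admitted letter `x` to a word `w` of the family. The
extended word `wx` may in turn be extended by the letters `y` of smaller rank that also extend
`w`, and by all `y` for which the monomial `xy` is not normal. -/
def extend (P : WordFamily S) : WordFamily S where
  I := {p : P.I × Atom S // p.2 ∈ P.letters p.1}
  rank p := Q.bound * P.rank p.1.1 + Q.rank p.1.2
  rank_injective := by
    rintro ⟨⟨i, x⟩, hx⟩ ⟨⟨j, y⟩, hy⟩ h
    simp only at h
    have hpos : 0 < Q.bound := (Nat.zero_le _).trans_lt (Q.rank_lt x)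
    have h₁ : P.rank i = P.rank j := by
      have := congrArg (· / Q.bound) h
      simpa [Nat.mul_add_div hpos, Nat.div_eq_of_lt (Q.rank_lt x),
        Nat.div_eq_of_lt (Q.rank_lt y)] using this
    have h₂ : Q.rank x = Q.rank y := by
      rw [h₁] at h
      omega
    obtain rfl := P.rank_injective h₁
    obtain rfl := Q.rank_injective h₂
    rfl
  weight p := P.weight p.1.1 + Finsupp.single p.1.2 1
  letters p := {y | (y ∈ P.letters p.1.1 ∧ Q.rank y < Q.rank p.1.2) ∨
    ¬ IsNormal Q.order (Finsupp.single p.1.2 1 + Finsupp.single y 1)}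

/-- Terms are compared by means of their total weight, then by means of the word. -/
def key (P : WordFamily S) (i : P.I) (s : S) : Q.order.syn ×ₗ ℕ :=
  toLex (Q.order.toSyn (Q.nf s + P.weight i), P.rank i)

/-- The key of a term in an extended family, with the last letter of the word disregarded in the
comparison of words. -/
def truncKey (P : WordFamily S) (j : (Q.extend P).I) (s : S) : Q.order.syn ×ₗ ℕ :=
  toLex (Q.order.toSyn (Q.nf s + (Q.extend P).weight j), P.rank j.1.1)

/-- The degree of a term in `S`. -/
def totalDegree (P : WordFamily S) (i : P.I) (s : S) : S :=
  s + factorization S (P.weight i)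

lemma key_injective {P : WordFamily S} {i j : P.I} {s t : S} (h : Q.key P i s = Q.key P j t) :
    i = j ∧ s = t := by
  have h' := toLex.injective h
  obtain ⟨h₁, h₂⟩ := Prod.mk.inj h'
  obtain rfl := P.rank_injective h₂
  have h₃ := add_right_cancel (Q.order.toSyn.injective h₁)
  exact ⟨rfl, by rw [← Q.factorization_nf s, h₃, Q.factorization_nf]⟩

lemma toLex_lt_toLex {α : Type*} [LinearOrder α] {a b : α} {m n : ℕ} :
    toLex (a, m) < toLex (b, n) ↔ a < b ∨ a = b ∧ m < n := Prod.Lex.toLex_lt_toLex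

lemma toLex_le_toLex {α : Type*} [LinearOrder α] {a b : α} {m n : ℕ} :
    toLex (a, m) ≤ toLex (b, n) ↔ a < b ∨ a = b ∧ m ≤ n := Prod.Lex.toLex_le_toLex

lemma extend_rank_lt {P : WordFamily S} {j l : (Q.extend P).I}
    (h : P.rank j.1.1 < P.rank l.1.1) : (Q.extend P).rank j < (Q.extend P).rank l := by
  have h₁ : Q.bound * (P.rank j.1.1 + 1) ≤ Q.bound * P.rank l.1.1 := Nat.mul_le_mul_left _ h
  have h₂ := Q.rank_lt j.1.2
  change Q.bound * _ + Q.rank _ < Q.bound * _ + Q.rank _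
  rw [mul_add, mul_one] at h₁
  omega

lemma key_lt_of_truncKey_lt {P : WordFamily S} {j l : (Q.extend P).I} {s t : S}
    (h : Q.truncKey P j s < Q.truncKey P l t) : Q.key (Q.extend P) j s < Q.key (Q.extend P) l t := by
  rw [truncKey, truncKey, toLex_lt_toLex] at h
  rw [key, key, toLex_lt_toLex]
  exact h.imp_right fun h => ⟨h.1, Q.extend_rank_lt h.2⟩

lemma truncKey_le_of_key_le {P : WordFamily S} {j l : (Q.extend P).I} {s t : S}
    (h : Q.key (Q.extend P) j s ≤ Q.key (Q.extend P) l t) : Q.truncKey P j s ≤ Q.truncKey P l t :=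
  le_of_not_gt fun h' => h.not_gt (Q.key_lt_of_truncKey_lt h')

/-- The key of the term `x · w` of the differential of `wx` is at most the truncated key, with
equality if no straightening is needed. -/
lemma key_add_le_truncKey {P : WordFamily S} (j : (Q.extend P).I) (s : S) :
    Q.key P j.1.1 (s + j.1.2) ≤ Q.truncKey P j s := by
  have h := Q.nf_add_le s j.1.2
  rw [Q.nf_atom] at h
  rw [key, truncKey, toLex_le_toLex]
  have h' : Q.order.toSyn (Q.nf (s + j.1.2) + P.weight j.1.1) ≤
      Q.order.toSyn (Q.nf s + (Q.extend P).weight j) := by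
    change _ ≤ Q.order.toSyn (Q.nf s + (P.weight j.1.1 + Finsupp.single j.1.2 1))
    rw [add_comm (P.weight j.1.1), ← add_assoc, map_add, map_add _ _ (P.weight j.1.1)]
    exact add_le_add_left h _
  exact h'.lt_or_eq.imp_right fun h => ⟨h, le_rfl⟩

lemma totalDegree_extend {P : WordFamily S} (j : (Q.extend P).I) (s : S) :
    totalDegree P j.1.1 (s + j.1.2) = totalDegree (Q.extend P) j s := by
  change _ = s + factorization S (P.weight j.1.1 + Finsupp.single j.1.2 1)
  rw [totalDegree, map_add, factorization_single, one_smul, add_assoc, add_comm (j.1.2 : S)]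

end Straightening

end Words

/-! ### The resolution -/

noncomputable section Resolution

universe u v

variable {k S : Type u} [Field k] [AddCommMonoid S]

namespace Straightening

variable (Q : Straightening.{u, v} S) {P : WordFamily S}

/-- The differential `d` sends the basis element of a word `wx` to `x` times the basis element of
`w`, up to terms with smaller key and the same degree in `S`. -/
def HasLeadingTerms (d : ((Q.extend P).I →₀ AddMonoidAlgebra k S) →ₗ[AddMonoidAlgebra k S]
    (P.I →₀ AddMonoidAlgebra k S)) : Prop :=
  ∀ j, d (Finsupp.single j 1) - term k j.1.1 (j.1.2 : S) ∈ termsIn k fun i s =>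
    Q.key P i s < Q.truncKey P j 0 ∧ totalDegree P i s = totalDegree (Q.extend P) j 0

/-- Some letter of the normal form of `s` may be appended to the word `i`. -/
def IsReducible (P : WordFamily S) (i : P.I) (s : S) : Prop :=
  ∃ x ∈ (Q.nf s).support, x ∈ P.letters i

/-- The term with the largest key of every nonzero element of `V` is reducible. -/
def MaxTermsReducible (V : Submodule k (P.I →₀ AddMonoidAlgebra k S)) : Prop :=
  ∀ f ∈ V, ∀ i s, (f i).coeff s ≠ 0 →
    (∀ i' s', (f i').coeff s' ≠ 0 → Q.key P i' s' ≤ Q.key P i s) → Q.IsReducible P i s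

variable {d : ((Q.extend P).I →₀ AddMonoidAlgebra k S) →ₗ[AddMonoidAlgebra k S]
    (P.I →₀ AddMonoidAlgebra k S)}

variable {Q} in
lemma HasLeadingTerms.sub_mem (hd : Q.HasLeadingTerms d) (j : (Q.extend P).I) (s : S) :
    d (term k j s) - term k j.1.1 (s + j.1.2) ∈ termsIn k fun i t =>
      Q.key P i t < Q.truncKey P j s ∧ totalDegree P i t = totalDegree (Q.extend P) j s := by
  have h₁ : term k j s = AddMonoidAlgebra.single s (1 : k) • Finsupp.single j 1 := by
    simp [term]
  have h₂ : term k j.1.1 (s + j.1.2) =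
      AddMonoidAlgebra.single s (1 : k) • term k j.1.1 (j.1.2 : S) := by
    simp [term, AddMonoidAlgebra.single_mul_single]
  rw [h₁, h₂, map_smul, ← smul_sub]
  refine smul_mem_termsIn ?_ (hd j)
  rintro i t ⟨hkey, hdeg⟩
  constructor
  · rw [key, truncKey, toLex_lt_toLex, Q.nf_zero, zero_add] at hkey
    rw [key, truncKey, toLex_lt_toLex]
    have h₃ : Q.order.toSyn (Q.nf (s + t) + P.weight i) ≤
        Q.order.toSyn (Q.nf s) + Q.order.toSyn (Q.nf t + P.weight i) := by
      rw [← map_add, ← add_assoc, map_add, map_add _ _ (P.weight i)]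
      exact add_le_add_left (Q.nf_add_le s t) _
    rw [map_add _ (Q.nf s) ((Q.extend P).weight j)]
    rcases hkey with h | ⟨h, hr⟩
    · exact Or.inl (h₃.trans_lt (add_lt_add_right h _))
    · rw [h] at h₃
      exact h₃.lt_or_eq.imp_right fun h => ⟨h, hr⟩
  · rw [totalDegree, totalDegree, zero_add] at hdeg
    rw [totalDegree, totalDegree, add_assoc, hdeg]

/-- If no letter of `nf s` may be appended to the word `wx`, then `x * nf s` is normal, because
all quadratic monomials dividing it are. -/
lemma isNormal_of_not_isReducible (j : (Q.extend P).I) (s : S)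
    (h : ¬ Q.IsReducible (Q.extend P) j s) :
    IsNormal Q.order (Q.nf s + Finsupp.single j.1.2 1) := by
  classical
  by_contra hn
  obtain ⟨u, v, huz, huv, hlt, hu, -⟩ := Q.reductions _ hn
  have hnu : ¬ IsNormal Q.order u := not_isNormal_of_lt huv.symm hlt
  set x := j.1.2 with hx
  -- The quadratic monomial `u` divides `x * nf s` but not `nf s`, so `x` divides `u`.
  have hux : Finsupp.single x 1 ≤ u := by
    rw [Finsupp.single_le_iff, Nat.one_le_iff_ne_zero]
    intro h0
    refine hnu ((Q.isNormal_nf s).of_le fun y => ?_)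
    have := huz y
    rw [Finsupp.add_apply, Finsupp.single_apply] at this
    split_ifs at this with hy
    · rw [← hy, h0]; exact Nat.zero_le _
    · simpa using this
  obtain ⟨t, rfl⟩ := exists_add_of_le hux
  rw [map_add, Finsupp.degree_single] at hu
  obtain ⟨y, rfl⟩ := exists_eq_single_of_degree_eq_one (x := t) (by omega)
  refine h ⟨y, ?_, Or.inr hnu⟩
  rw [add_comm, add_le_add_iff_right] at huz
  rw [Finsupp.mem_support_iff, ← Nat.one_le_iff_ne_zero, ← Finsupp.single_le_iff]
  exact huz

/-- The leading terms of cycles are reducible: the image of an irreducible leading term could not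
cancel. -/
lemma maxTermsReducible_ker (hd : Q.HasLeadingTerms d) :
    Q.MaxTermsReducible (P := Q.extend P) (LinearMap.ker (d.restrictScalars k)) := by
  classical
  intro z hz j s hjs hmax
  by_contra hred
  have hnorm := Q.isNormal_of_not_isReducible j s hred
  have hnf : Q.nf (s + j.1.2) = Q.nf s + Finsupp.single j.1.2 1 := by
    have := Q.nf_factorization hnorm
    rwa [map_add, Q.factorization_nf, factorization_single, one_smul] at this
  have hkey : Q.key P j.1.1 (s + j.1.2) = Q.truncKey P j s := by
    rw [key, truncKey, hnf]
    change toLex (Q.order.toSyn (Q.nf s + _ + P.weight j.1.1), _) =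
      toLex (Q.order.toSyn (Q.nf s + (P.weight j.1.1 + _)), _)
    rw [add_assoc, add_comm (P.weight j.1.1)]
  let c := (z j).coeff s
  -- The elements in which the term `x · s` at the word `w` does not occur, where `j = wx`.
  let U : Submodule k (P.I →₀ AddMonoidAlgebra k S) :=
    termsIn k fun i t => ¬ (i = j.1.1 ∧ t = s + j.1.2)
  have hU : ∀ f, f ∈ U ↔ (f j.1.1).coeff (s + j.1.2) = 0 := by
    intro f
    constructor
    · intro hf
      by_contra h0
      exact hf _ _ h0 ⟨rfl, rfl⟩
    · rintro hf i t hit ⟨rfl, rfl⟩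
      exact hit hf
  have hlow : ∀ j' s', Q.truncKey P j' s' ≤ Q.truncKey P j s →
      d (term k j' s') - term k j'.1.1 (s' + j'.1.2) ∈ U := by
    intro j' s' hle
    refine termsIn_mono ?_ (hd.sub_mem j' s')
    rintro i t ⟨hlt, -⟩ ⟨rfl, rfl⟩
    rw [hkey] at hlt
    exact hlt.not_ge hle
  have hz' : z - c • term k j s ∈ termsIn k fun j' s' =>
      Q.key (Q.extend P) j' s' ≤ Q.key (Q.extend P) j s ∧ ¬ (j' = j ∧ s' = s) := by
    intro j' s' hne
    by_cases h' : j' = j ∧ s' = s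
    · refine absurd ?_ hne
      obtain ⟨rfl, rfl⟩ := h'
      simp [coeff_term_self, c]
    · refine ⟨hmax j' s' fun h0 => hne ?_, h'⟩
      simp [coeff_term_of_ne h', h0]
  have hdz' : d (z - c • term k j s) ∈ U := by
    refine map_mem_of_termsIn d ?_ hz'
    rintro j' s' ⟨hle, hne⟩
    rw [← sub_add_cancel (d (term k j' s')) (term k j'.1.1 (s' + j'.1.2))]
    refine U.add_mem (hlow j' s' (Q.truncKey_le_of_key_le hle)) (term_mem_termsIn ?_)
    rintro ⟨hi, ht⟩
    rw [key, key, toLex_le_toLex] at hle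
    have hle₁ : Q.order.toSyn (Q.nf s + Finsupp.single j.1.2 1) ≤
        Q.order.toSyn (Q.nf s' + Finsupp.single j'.1.2 1) := by
      have := Q.nf_add_le s' j'.1.2
      rwa [Q.nf_atom, ht, hnf] at this
    have hw : ∀ (l : (Q.extend P).I) (t : S), Q.nf t + (Q.extend P).weight l =
        (Q.nf t + Finsupp.single l.1.2 1) + P.weight l.1.1 := by
      intro l t
      change _ + (_ + _) = _
      rw [add_assoc, add_comm (P.weight l.1.1)]
    rw [hw, hw, hi, map_add, map_add _ _ (P.weight j.1.1)] at hle
    obtain ⟨heq, hrank⟩ := hle.resolve_left (not_lt.2 (add_le_add_left hle₁ _))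
    have heq' : Q.nf s' + Finsupp.single j'.1.2 1 = Q.nf s + Finsupp.single j.1.2 1 :=
      Q.order.toSyn.injective (add_right_cancel heq)
    change Q.bound * P.rank j'.1.1 + Q.rank j'.1.2 ≤ Q.bound * P.rank j.1.1 + Q.rank j.1.2
      at hrank
    rw [hi] at hrank
    have hx : j'.1.2 ≠ j.1.2 := by
      intro hx
      refine hne ⟨Subtype.ext (Prod.ext hi hx), ?_⟩
      rw [hx] at heq'
      rw [← Q.factorization_nf s', add_right_cancel heq', Q.factorization_nf]
    have hrank' : Q.rank j'.1.2 < Q.rank j.1.2 :=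
      lt_of_le_of_ne (by omega) (Q.rank_injective.ne hx)
    refine hred ⟨j'.1.2, ?_, Or.inl ⟨hi ▸ j'.2, hrank'⟩⟩
    have := DFunLike.congr_fun heq' j'.1.2
    rw [Finsupp.add_apply, Finsupp.add_apply, Finsupp.single_eq_same,
      Finsupp.single_eq_of_ne hx] at this
    rw [Finsupp.mem_support_iff]
    omega
  have hdz : d z = 0 := hz
  have h1 := U.add_mem hdz' (U.smul_mem c (hlow j s le_rfl))
  have h2 : d (z - c • term k j s) + c • (d (term k j s) - term k j.1.1 (s + j.1.2)) =
      -(c • term k j.1.1 (s + j.1.2)) := by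
    rw [map_sub, hdz, LinearMap.map_smul_of_tower, smul_sub]
    abel
  rw [h2, Submodule.neg_mem_iff, hU] at h1
  refine hjs ?_
  simpa [coeff_term_self] using h1

/-- If all leading terms in `V` are reducible, then the elements of `V` are boundaries, and they
bound elements with terms that are as small as the leading terms allow. The set `D` restricts
the degrees in `S`. -/
lemma exists_map_eq [WellFoundedLT Q.order.syn] (hd : Q.HasLeadingTerms d)
    {V : Submodule k (P.I →₀ AddMonoidAlgebra k S)} (hV : Q.MaxTermsReducible V)
    (hdV : ∀ f, d f ∈ V) (D : Set S) (κ : Q.order.syn ×ₗ ℕ) :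
    ∀ z ∈ V, (z ∈ termsIn k fun i s => Q.key P i s < κ ∧ totalDegree P i s ∈ D) →
      ∃ y ∈ termsIn k fun j s => Q.truncKey P j s < κ ∧ totalDegree (Q.extend P) j s ∈ D,
        d y = z := by
  induction κ using WellFoundedLT.induction with
  | _ κ ih =>
    intro z hzV hz
    rcases eq_or_ne z 0 with rfl | hz0
    · exact ⟨0, Submodule.zero_mem _, map_zero d⟩
    obtain ⟨i, s, his, hmax⟩ := exists_max_term (Q.key P) hz0
    obtain ⟨x, hxs, hxi⟩ := hV z hzV i s his hmax
    obtain ⟨t, ht⟩ := exists_add_of_le (show Finsupp.single x 1 ≤ Q.nf s from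
      Finsupp.single_le_iff.2 (Nat.one_le_iff_ne_zero.2 (Finsupp.mem_support_iff.1 hxs)))
    let j : (Q.extend P).I := ⟨(i, x), hxi⟩
    let s₀ := factorization S t
    have hs₀ : s₀ + x = s := by
      rw [← Q.factorization_nf s, ht, map_add, factorization_single, one_smul, add_comm]
    have hnf : Q.nf s₀ = t := Q.nf_factorization ((Q.isNormal_nf s).of_le (by
      rw [ht]; exact le_add_self))
    have hkey : Q.truncKey P j s₀ = Q.key P i s := by
      rw [key, truncKey, hnf, ht]
      change toLex (Q.order.toSyn (t + (P.weight i + Finsupp.single x 1)), _) = _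
      rw [add_comm (P.weight i), ← add_assoc, add_comm t]
    have hdeg : totalDegree (Q.extend P) j s₀ = totalDegree P i s := by
      rw [← Q.totalDegree_extend j s₀]
      exact congrArg (totalDegree P i) hs₀
    obtain ⟨hκ, hD⟩ := hz i s his
    have hlead := hd.sub_mem j s₀
    change d (term k j s₀) - term k i (s₀ + x) ∈ _ at hlead
    rw [hs₀, hkey, hdeg] at hlead
    let c := (z i).coeff s
    have hz' : z - c • d (term k j s₀) ∈ termsIn k fun i' s' =>
        Q.key P i' s' < Q.key P i s ∧ totalDegree P i' s' ∈ D := by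
      have h₁ : z - c • term k i s ∈ termsIn k fun i' s' =>
          Q.key P i' s' < Q.key P i s ∧ totalDegree P i' s' ∈ D := by
        intro i' s' hne
        by_cases h' : i' = i ∧ s' = s
        · refine absurd ?_ hne
          obtain ⟨rfl, rfl⟩ := h'
          simp [coeff_term_self, c]
        · have h0 : (z i').coeff s' ≠ 0 := fun h0 => hne (by simp [coeff_term_of_ne h', h0])
          exact ⟨lt_of_le_of_ne (hmax i' s' h0) fun h => h' (Q.key_injective h),
            (hz i' s' h0).2⟩
      have h₂ := Submodule.sub_mem _ h₁ (Submodule.smul_mem _ c (termsIn_mono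
        (R' := fun i' s' => Q.key P i' s' < Q.key P i s ∧ totalDegree P i' s' ∈ D)
        (fun i' s' h => ⟨h.1, by rw [h.2]; exact hD⟩) hlead))
      convert h₂ using 1
      rw [smul_sub]
      abel
    obtain ⟨y, hy, hdy⟩ := ih _ hκ _ (V.sub_mem hzV (V.smul_mem c (hdV _))) hz'
    refine ⟨y + c • term k j s₀, Submodule.add_mem _
      (termsIn_mono (fun _ _ h => ⟨h.1.trans hκ, h.2⟩) hy)
      (Submodule.smul_mem _ _ (term_mem_termsIn ⟨hkey ▸ hκ, hdeg ▸ hD⟩)), ?_⟩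
    rw [map_add, hdy, LinearMap.map_smul_of_tower, sub_add_cancel]

lemma exists_map_eq_of_mem (hd : Q.HasLeadingTerms d)
    {V : Submodule k (P.I →₀ AddMonoidAlgebra k S)} (hV : Q.MaxTermsReducible V)
    (hdV : ∀ f, d f ∈ V) {z : P.I →₀ AddMonoidAlgebra k S} (hz : z ∈ V) : ∃ y, d y = z := by
  rcases eq_or_ne z 0 with rfl | hz0
  · exact ⟨0, map_zero d⟩
  obtain ⟨i, s, -, hmax⟩ := exists_max_term (Q.key P) hz0
  obtain ⟨y, -, hy⟩ := Q.exists_map_eq hd hV hdV Set.univ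
    (toLex (Q.order.toSyn (Q.nf s + P.weight i), P.rank i + 1)) z hz fun i' s' h' =>
      ⟨(hmax i' s' h').trans_lt (toLex_lt_toLex.2 (Or.inr ⟨rfl, Nat.lt_succ_self _⟩)), trivial⟩
  exact ⟨y, hy⟩

/-- For every word `wyx` the element `x · [wy]` can be completed by smaller terms to a cycle. If
`xy` is normal, then the leading term `xy · [w]` of the image of `x · [wy]` is cancelled by that
of `y · [wx]`; otherwise it is straightened. What remains is a boundary of smaller elements. -/
lemma exists_cycle (hd : Q.HasLeadingTerms d)
    (hV : Q.MaxTermsReducible (LinearMap.range (d.restrictScalars k)))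
    (l : (Q.extend (Q.extend P)).I) :
    ∃ z, d z = 0 ∧ z - term k l.1.1 (l.1.2 : S) ∈ termsIn k fun j s =>
      Q.key (Q.extend P) j s < Q.truncKey (Q.extend P) l 0 ∧
        totalDegree (Q.extend P) j s = totalDegree (Q.extend (Q.extend P)) l 0 := by
  let j : (Q.extend P).I := l.1.1
  let x : Atom S := l.1.2
  have hx : x ∈ (Q.extend P).letters j := l.2
  let δ := totalDegree (Q.extend P) j x
  have hδ : totalDegree (Q.extend (Q.extend P)) l 0 = δ := by
    rw [← Q.totalDegree_extend l 0, zero_add]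
  let κ := Q.truncKey P j x
  -- Restoring the last letter of `wy` turns bounds by `κ` into the required ones.
  have hκ : ∀ (j' : (Q.extend P).I) s', Q.truncKey P j' s' < κ →
      Q.key (Q.extend P) j' s' < Q.truncKey (Q.extend P) l 0 := by
    intro j' s' h
    have := Q.key_lt_of_truncKey_lt h
    refine this.trans_eq ?_
    rw [key, truncKey, Q.nf_atom, Q.nf_zero]
    change _ = toLex (Q.order.toSyn (0 + ((Q.extend P).weight j + Finsupp.single x 1)), _)
    rw [zero_add, add_comm]
  have finish : ∀ y, (d y ∈ termsIn k fun i s => Q.key P i s < κ ∧ totalDegree P i s ∈ ({δ} : Set S)) →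
      (y - term k j (x : S) ∈ termsIn k fun j s =>
        Q.key (Q.extend P) j s < Q.truncKey (Q.extend P) l 0 ∧
        totalDegree (Q.extend P) j s = δ) →
      ∃ z, d z = 0 ∧ z - term k j (x : S) ∈ termsIn k fun j' s =>
        Q.key (Q.extend P) j' s < Q.truncKey (Q.extend P) l 0 ∧
        totalDegree (Q.extend P) j' s = δ := by
    intro y hy hyx
    obtain ⟨y', hy', hdy'⟩ := Q.exists_map_eq hd hV (fun f => ⟨f, rfl⟩) {δ} κ _ ⟨y, rfl⟩ hy
    refine ⟨y - y', ?_, ?_⟩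
    · rw [map_sub, hdy']
      exact sub_self _
    · rw [sub_right_comm]
      exact Submodule.sub_mem _ hyx (termsIn_mono (fun j' s' h => ⟨hκ j' s' h.1, h.2⟩) hy')
  rw [hδ]
  change ∃ z, d z = 0 ∧ z - term k j (x : S) ∈ _
  have hlead := hd.sub_mem j x
  by_cases hnorm : IsNormal Q.order (Finsupp.single j.1.2 1 + Finsupp.single x 1)
  · obtain ⟨hxi, hrank⟩ : x ∈ P.letters j.1.1 ∧ Q.rank x < Q.rank j.1.2 :=
      hx.resolve_right (not_not.2 hnorm)
    let j' : (Q.extend P).I := ⟨(j.1.1, x), hxi⟩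
    have hκ' : Q.truncKey P j' j.1.2 = κ := by
      change toLex (Q.order.toSyn (_ + (P.weight j.1.1 + Finsupp.single x 1)), _) =
        toLex (Q.order.toSyn (_ + (P.weight j.1.1 + Finsupp.single j.1.2 1)), _)
      rw [Q.nf_atom, Q.nf_atom, add_left_comm, add_left_comm (Finsupp.single x 1),
        add_comm (Finsupp.single x 1)]
    have hδ' : totalDegree (Q.extend P) j' j.1.2 = δ := by
      rw [← Q.totalDegree_extend]
      change totalDegree P j.1.1 (j.1.2 + x) = δ
      rw [add_comm, Q.totalDegree_extend]
    have hlead' := hd.sub_mem j' j.1.2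
    rw [hκ', hδ'] at hlead'
    refine finish (term k j (x : S) - term k j' (j.1.2 : S)) ?_ ?_
    · have := Submodule.sub_mem _ hlead hlead'
      change _ - term k j.1.1 _ - (_ - term k j.1.1 ((j.1.2 : S) + x)) ∈ _ at this
      rw [add_comm (j.1.2 : S), sub_sub_sub_cancel_right] at this
      rw [map_sub]
      exact this
    · rw [sub_sub_cancel_left, Submodule.neg_mem_iff]
      refine term_mem_termsIn ⟨?_, hδ'⟩
      rw [key, truncKey, toLex_lt_toLex]
      refine Or.inr ⟨?_, ?_⟩
      · change Q.order.toSyn (_ + (P.weight j.1.1 + Finsupp.single x 1)) =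
          Q.order.toSyn (_ + ((P.weight j.1.1 + Finsupp.single j.1.2 1) + Finsupp.single x 1))
        rw [Q.nf_atom, Q.nf_zero, zero_add, add_left_comm, add_assoc]
      · change Q.bound * P.rank j.1.1 + Q.rank x < Q.bound * P.rank j.1.1 + Q.rank j.1.2
        omega
  · refine finish (term k j (x : S)) ?_ (by rw [sub_self]; exact Submodule.zero_mem _)
    rw [← sub_add_cancel (d (term k j (x : S))) (term k j.1.1 ((x : S) + j.1.2))]
    refine Submodule.add_mem _ hlead (term_mem_termsIn ⟨?_, Q.totalDegree_extend j x⟩)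
    refine lt_of_le_of_ne (Q.key_add_le_truncKey j x) fun heq => hnorm ?_
    have h₁ := congrArg Prod.fst (toLex.injective heq)
    have h₂ : Q.nf (x + j.1.2) + P.weight j.1.1 =
      Q.nf x + (P.weight j.1.1 + Finsupp.single j.1.2 1) := Q.order.toSyn.injective h₁
    rw [add_comm (P.weight j.1.1), ← add_assoc, add_left_inj, Q.nf_atom] at h₂
    rw [add_comm, ← h₂]
    exact Q.isNormal_nf _

lemma exists_next (hd : Q.HasLeadingTerms d)
    (hV : Q.MaxTermsReducible (LinearMap.range (d.restrictScalars k))) :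
    ∃ d' : ((Q.extend (Q.extend P)).I →₀ AddMonoidAlgebra k S) →ₗ[AddMonoidAlgebra k S]
      ((Q.extend P).I →₀ AddMonoidAlgebra k S), Q.HasLeadingTerms d' ∧
      Q.MaxTermsReducible (LinearMap.range (d'.restrictScalars k)) ∧ Function.Exact d' d := by
  choose z hdz hz using Q.exists_cycle hd hV
  let d' := Finsupp.linearCombination (AddMonoidAlgebra k S) z
  have hd' : Q.HasLeadingTerms d' := by
    intro l
    simpa [d'] using hz l
  have hdd' : ∀ y, d (d' y) = 0 := by
    intro y
    rw [Finsupp.linearCombination_apply, map_finsuppSum]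
    exact Finset.sum_eq_zero fun l _ => by
      rw [← smul_zero (y l), ← hdz l]
      exact map_smul d _ _
  have hker := Q.maxTermsReducible_ker hd
  refine ⟨d', hd', ?_, fun y => ⟨fun hy => ?_, ?_⟩⟩
  · rintro _ ⟨y, rfl⟩
    exact hker _ (hdd' y)
  · exact Q.exists_map_eq_of_mem hd' hker hdd' hy
  · rintro ⟨y, rfl⟩
    exact hdd' y

end Straightening

end Resolution

/-! ### The grading and the Koszul property -/

noncomputable section KoszulProperty

universe u v

variable {S : Type u} [AddCommMonoid S]

lemma finrank_lengthGrading_zero (k : Type*) [Field k] :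
    Module.finrank k (lengthGrading S k 0) = 1 := by
  have : lengthGrading S k 0 = Submodule.span k {AddMonoidAlgebra.single (0 : S) (1 : k)} := by
    refine congrArg _ (Set.ext fun f => ⟨?_, ?_⟩)
    · rintro ⟨z, hz, rfl⟩
      rw [(Finsupp.degree_eq_zero_iff z).1 hz, map_zero]
      rfl
    · rintro rfl
      exact ⟨0, map_zero _, by rw [map_zero]⟩
  rw [this]
  exact finrank_span_singleton (by simp)

namespace Straightening

variable (Q : Straightening.{u, v} S)

/-- The number of atoms in any factorization of an element. -/
def length : S →+ ℕ where
  toFun s := (Q.nf s).degree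
  map_zero' := by rw [Q.nf_zero, map_zero]
  map_add' s t := by
    rw [← map_add]
    refine Q.reductions.degree_eq ?_
    rw [map_add, Q.factorization_nf, Q.factorization_nf, Q.factorization_nf]

lemma length_factorization (z : Atom S →₀ ℕ) : Q.length (factorization S z) = z.degree :=
  Q.reductions.degree_eq (Q.factorization_nf _)

lemma length_eq_zero_iff {s : S} : Q.length s = 0 ↔ s = 0 := by
  constructor
  · intro h
    rw [← Q.factorization_nf s, (Finsupp.degree_eq_zero_iff (Q.nf s)).1 h, map_zero]
  · rintro rfl
    exact map_zero _

lemma lengthGrading_eq (k : Type*) [Field k] :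
    lengthGrading S k = AddMonoidAlgebra.gradeBy k Q.length := by
  funext n
  refine le_antisymm (Submodule.span_le.2 ?_) ?_
  · rintro _ ⟨z, rfl, rfl⟩
    have := AddMonoidAlgebra.single_mem_gradeBy Q.length (factorization S z) (1 : k)
    rwa [Q.length_factorization] at this
  · intro a ha
    rw [← AddMonoidAlgebra.sum_coeff_single a]
    refine Submodule.sum_mem _ fun s hs => ?_
    rw [AddMonoidAlgebra.mem_gradeBy_iff] at ha
    have : AddMonoidAlgebra.single s (a.coeff s) =
        a.coeff s • AddMonoidAlgebra.single (factorization S (Q.nf s)) (1 : k) := by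
      rw [Q.factorization_nf, AddMonoidAlgebra.smul_single, smul_eq_mul, mul_one]
    rw [this]
    exact Submodule.smul_mem _ _ (Submodule.subset_span ⟨Q.nf s, ha hs, rfl⟩)

lemma mem_lengthGrading_iff {k : Type*} [Field k] {n : ℕ} {a : AddMonoidAlgebra k S} :
    a ∈ lengthGrading S k n ↔ ∀ s, a.coeff s ≠ 0 → Q.length s = n := by
  rw [Q.lengthGrading_eq, AddMonoidAlgebra.mem_gradeBy_iff]
  exact ⟨fun h s hs => h (Finsupp.mem_support_iff.2 hs),
    fun h s hs => h s (Finsupp.mem_support_iff.1 hs)⟩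

/-- Giving every atom degree one defines a grading of the semigroup algebra. -/
@[reducible]
def gradedAlgebra (k : Type*) [Field k] : GradedAlgebra (lengthGrading S k) :=
  Q.lengthGrading_eq k ▸ AddMonoidAlgebra.gradeBy.gradedAlgebra Q.length

lemma mem_irrelevant_iff (Q : Straightening.{u, v} S) {k : Type*} [Field k] [GradedAlgebra (lengthGrading S k)]
    (a : AddMonoidAlgebra k S) :
    a ∈ (HomogeneousIdeal.irrelevant (lengthGrading S k)).toIdeal ↔ a.coeff 0 = 0 := by
  classical
  have key : GradedRing.proj (lengthGrading S k) 0 a = AddMonoidAlgebra.single 0 (a.coeff 0) := by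
    induction a using AddMonoidAlgebra.induction_linear with
    | zero => simp
    | add x y hx hy =>
      rw [map_add, hx, hy, AddMonoidAlgebra.coeff_add, Finsupp.add_apply,
        AddMonoidAlgebra.single_add]
    | single s r =>
      have hmem : AddMonoidAlgebra.single s r ∈ lengthGrading S k (Q.length s) := by
        rw [Q.lengthGrading_eq]
        exact AddMonoidAlgebra.single_mem_gradeBy _ _ _
      rw [GradedRing.proj_apply, AddMonoidAlgebra.coeff_single, Finsupp.single_apply]
      split_ifs with hs
      · subst hs
        rw [map_zero] at hmem
        rw [DirectSum.decompose_of_mem_same _ hmem]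
      · rw [DirectSum.decompose_of_mem_ne _ hmem fun h => hs (Q.length_eq_zero_iff.1 h),
          AddMonoidAlgebra.single_zero]
  change a ∈ HomogeneousIdeal.irrelevant (lengthGrading S k) ↔ _
  rw [HomogeneousIdeal.mem_irrelevant_iff, key,
    AddMonoidAlgebra.single_eq_zero]

/-- The words of length `n`. -/
def words : ℕ → WordFamily S
  | 0 => emptyWord S
  | n + 1 => Q.extend (words n)

lemma degree_weight : ∀ (n : ℕ) (i : (Q.words n).I), ((Q.words n).weight i).degree = n
  | 0, _ => map_zero _
  | n + 1, i => by
    change ((Q.words n).weight i.1.1 + Finsupp.single i.1.2 1).degree = n + 1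
    rw [map_add, degree_weight n, Finsupp.degree_single]

variable {k : Type u} [Field k]

/-- The coordinates of the differentials are linear, since they preserve the degree in `S`. -/
lemma HasLeadingTerms.mem_lengthGrading {Q : Straightening.{u, v} S} {n : ℕ}
    {d : ((Q.words (n + 1)).I →₀ AddMonoidAlgebra k S) →ₗ[AddMonoidAlgebra k S]
      ((Q.words n).I →₀ AddMonoidAlgebra k S)} (hd : Q.HasLeadingTerms d)
    (j : (Q.words (n + 1)).I) (i : (Q.words n).I) :
    d (Finsupp.single j 1) i ∈ lengthGrading S k 1 := by
  have h : d (Finsupp.single j 1) ∈ termsIn k fun i s =>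
      totalDegree (Q.words n) i s = totalDegree (Q.words (n + 1)) j 0 := by
    rw [← sub_add_cancel (d (Finsupp.single j 1)) (term k j.1.1 (j.1.2 : S))]
    refine Submodule.add_mem _ (termsIn_mono (fun _ _ h => h.2) (hd j)) (term_mem_termsIn ?_)
    have := Q.totalDegree_extend j 0
    rwa [zero_add] at this
  rw [Q.mem_lengthGrading_iff]
  intro s hs
  have := congrArg Q.length (h i s hs)
  rw [totalDegree, totalDegree, zero_add, map_add, Q.length_factorization,
    Q.length_factorization, Q.degree_weight, Q.degree_weight] at this
  omega

/-- On the empty word, all terms other than the constant one are reducible. -/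
lemma maxTermsReducible_emptyWord :
    Q.MaxTermsReducible (P := emptyWord S) (termsIn k fun _ s => s ≠ 0) := by
  intro f hf i s hs _
  have hne : Q.nf s ≠ 0 := fun h => hf i s hs (by rw [← Q.factorization_nf s, h, map_zero])
  obtain ⟨x, hx⟩ := Finsupp.support_nonempty_iff.2 hne
  exact ⟨x, hx, trivial⟩

/-- The first differential sends the basis element of a letter to this letter. -/
lemma exists_first_differential :
    ∃ d : ((Q.extend (emptyWord S)).I →₀ AddMonoidAlgebra k S) →ₗ[AddMonoidAlgebra k S]
      ((emptyWord S).I →₀ AddMonoidAlgebra k S), Q.HasLeadingTerms d ∧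
      ∀ f, d f ∈ termsIn k fun (_ : (emptyWord S).I) s => s ≠ 0 := by
  refine ⟨Finsupp.linearCombination _ fun j => term k j.1.1 (j.1.2 : S), fun j => ?_,
    fun f => ?_⟩
  · rw [Finsupp.linearCombination_single, one_smul, sub_self]
    exact Submodule.zero_mem _
  · refine map_mem_of_termsIn (R := fun _ _ => True) _ (fun j s _ => ?_) fun _ _ _ => trivial
    have : Finsupp.linearCombination (AddMonoidAlgebra k S)
        (fun j : (Q.extend (emptyWord S)).I => term k j.1.1 (j.1.2 : S)) (term k j s) =
        term k j.1.1 (s + j.1.2) := by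
      rw [term, Finsupp.linearCombination_single]
      simp [term, AddMonoidAlgebra.single_mul_single]
    rw [this]
    refine term_mem_termsIn fun h0 => ?_
    have := congrArg Q.length h0
    rw [map_add, map_zero, ← one_smul ℕ (j.1.2 : S), ← factorization_single,
      Q.length_factorization, Finsupp.degree_single] at this
    omega

lemma exists_resolution (Q : Straightening.{u, v} S) :
    ∃ d : ∀ n, ((Q.words (n + 1)).I →₀ AddMonoidAlgebra k S) →ₗ[AddMonoidAlgebra k S]
      ((Q.words n).I →₀ AddMonoidAlgebra k S), (∀ n, Q.HasLeadingTerms (d n)) ∧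
      (∀ z, z ∈ Set.range (d 0) ↔ z ∈ termsIn k fun _ s => s ≠ 0) ∧
      ∀ n, Function.Exact (d (n + 1)) (d n) := by
  let Step (n : ℕ) := {d : ((Q.words (n + 1)).I →₀ AddMonoidAlgebra k S) →ₗ[AddMonoidAlgebra k S]
    ((Q.words n).I →₀ AddMonoidAlgebra k S) // Q.HasLeadingTerms d ∧
      Q.MaxTermsReducible (LinearMap.range (d.restrictScalars k))}
  have next : ∀ (n : ℕ) (d : Step n), ∃ d' : Step (n + 1), Function.Exact d'.1 d.1 := by
    intro n d
    obtain ⟨d', h₁, h₂, h₃⟩ := Q.exists_next d.2.1 d.2.2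
    exact ⟨⟨d', h₁, h₂⟩, h₃⟩
  choose f hf using next
  obtain ⟨d₀, hd₀, hmem⟩ := Q.exists_first_differential (k := k)
  have hred := Q.maxTermsReducible_emptyWord (k := k)
  let D : ∀ n, Step n := fun n => Nat.rec ⟨d₀, hd₀, by
    rintro _ ⟨y, rfl⟩
    exact hred _ (hmem y)⟩ f n
  refine ⟨fun n => (D n).1, fun n => (D n).2.1, ?_, fun n => hf n (D n)⟩
  refine fun z => ⟨?_, fun hz => Q.exists_map_eq_of_mem hd₀ hred hmem hz⟩
  rintro ⟨y, rfl⟩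
  exact hmem y

theorem isKoszul (Q : Straightening.{u, v} S) [GradedAlgebra (lengthGrading S k)] : IsKoszul (lengthGrading S k) := by
  obtain ⟨d, hd, hd₀, hexact⟩ := Q.exists_resolution (k := k)
  let J := (HomogeneousIdeal.irrelevant (lengthGrading S k)).toIdeal
  let ε : ((Q.words 0).I →₀ AddMonoidAlgebra k S) →ₗ[AddMonoidAlgebra k S]
      AddMonoidAlgebra k S ⧸ J := J.mkQ ∘ₗ Finsupp.lapply PUnit.unit
  refine ⟨finrank_lengthGrading_zero k, fun n => (Q.words n).I, ε, d, ?_, ?_, hexact,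
    fun n j i => (hd n).mem_lengthGrading j i⟩
  · intro q
    obtain ⟨a, rfl⟩ := J.mkQ_surjective q
    exact ⟨Finsupp.single PUnit.unit a, congrArg J.mkQ Finsupp.single_eq_same⟩
  · intro z
    change J.mkQ (z PUnit.unit) = 0 ↔ z ∈ Set.range (d 0)
    rw [hd₀, Submodule.mkQ_apply, Submodule.Quotient.mk_eq_zero, Q.mem_irrelevant_iff]
    constructor
    · rintro h i s hs rfl
      exact hs h
    · intro h
      by_contra h0
      exact h PUnit.unit 0 h0 rfl

end Straightening

/-- Quadratic reductions make the semigroup algebra of an atomic monoid with finitely many atoms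
a Koszul algebra. -/
theorem exists_gradedAlgebra_isKoszul (k : Type u) [Field k] [Finite (Atom S)]
    (hS : Function.Surjective (factorization S)) {m : MonomialOrder.{u, v} (Atom S)}
    (hm : HasQuadraticReductions m) :
    ∃ _ : GradedAlgebra (lengthGrading S k), IsKoszul (lengthGrading S k) := by
  have hnf : ∀ s, ∃ z, factorization S z = s ∧ IsNormal m z := by
    intro s
    obtain ⟨w, rfl⟩ := hS s
    exact exists_isNormal m w
  choose nf h₁ h₂ using hnf
  obtain ⟨n, ⟨e⟩⟩ := Finite.exists_equiv_fin (Atom S)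
  let Q : Straightening S := {
    order := m
    reductions := hm
    nf := nf
    factorization_nf := h₁
    isNormal_nf := h₂
    rank := fun a => e a
    rank_injective := fun a b h => e.injective (Fin.ext h)
    bound := n
    rank_lt := fun a => (e a).2 }
  let _ := Q.gradedAlgebra k
  exact ⟨Q.gradedAlgebra k, Q.isKoszul⟩

end KoszulProperty

/-! ### Block monoids of families -/

noncomputable section Families

universe u

variable {G : Type*} [CommGroup G] {ι : Type*} [Fintype ι]

/-- The monoid of all `α : ι → ℕ` with `∏ i, g i ^ α i = 1`, for a finite family `g` of elements
of an abelian group. -/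
def ofFamily (g : ι → G) : AddSubmonoid (ι → ℕ) where
  carrier := {α | ∏ i, g i ^ α i = 1}
  zero_mem' := by simp
  add_mem' := by
    intro α β hα hβ
    simp only [Set.mem_ofPred_eq] at hα hβ ⊢
    simp only [Pi.add_apply, pow_add, Finset.prod_mul_distrib, hα, hβ, mul_one]

lemma mem_ofFamily {g : ι → G} {α : ι → ℕ} : α ∈ ofFamily g ↔ ∏ i, g i ^ α i = 1 := Iff.rfl

instance subsingleton_addUnits_submonoid {ι : Type*} (M : AddSubmonoid (ι → ℕ)) :
    Subsingleton (AddUnits M) := by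
  refine ⟨fun a b => AddUnits.ext (Subtype.ext (funext fun i => ?_))⟩
  have h : ∀ c : AddUnits M, (c : M).1 i = 0 := by
    intro c
    have := congrArg (fun x : M => x.1 i) c.add_neg
    change (c : M).1 i + _ = 0 at this
    omega
  rw [h a, h b]

/-- As differences of elements of the block monoid that have nonnegative coordinates belong to
the block monoid, its atoms are pairwise incomparable. -/
instance finite_atom_ofFamily (g : ι → G) : Finite (Atom (ofFamily g)) := by
  have hinj : Function.Injective fun a : Atom (ofFamily g) => (a : ofFamily g).1 :=
    fun a b h => Subtype.ext (Subtype.ext h)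
  refine Set.finite_range_iff hinj |>.1 ?_
  refine WellQuasiOrderedLE.finite_of_isAntichain ?_
  rintro _ ⟨a, rfl⟩ _ ⟨b, rfl⟩ hne hle
  obtain ⟨γ, hγ⟩ := exists_add_of_le hle
  have hmem : γ ∈ ofFamily g := by
    have hb := mem_ofFamily.1 b.1.2
    have ha := mem_ofFamily.1 a.1.2
    rw [mem_ofFamily]
    simp only [hγ, Pi.add_apply, pow_add, Finset.prod_mul_distrib, ha, one_mul] at hb
    exact hb
  have hab : (b : ofFamily g) = a + ⟨γ, hmem⟩ := Subtype.ext hγ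
  rcases b.2.isAddUnit_or_isAddUnit hab with h | h
  · exact a.2.not_isAddUnit h
  · rw [isAddUnit_iff_eq_zero] at h
    rw [h, add_zero] at hab
    exact hne (congrArg Subtype.val hab.symm)

/-- Every element of a block monoid is a sum of atoms, by induction on the sum of its
coordinates. -/
lemma factorization_surjective (M : AddSubmonoid (ι → ℕ)) :
    Function.Surjective (factorization M) := by
  have key : ∀ (n : ℕ) (s : M), ∑ i, s.1 i = n → ∃ z, factorization M z = s := by
    intro n
    induction n using Nat.strong_induction_on with
    | _ n ih =>
      intro s hs
      rcases eq_or_ne s 0 with rfl | hs0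
      · exact ⟨0, map_zero _⟩
      by_cases hirr : AddIrreducible s
      · exact ⟨Finsupp.single ⟨s, hirr⟩ 1, by rw [factorization_single, one_smul]⟩
      obtain ⟨a, b, rfl, ha, hb⟩ : ∃ a b, s = a + b ∧ a ≠ 0 ∧ b ≠ 0 := by
        by_contra! h
        refine hirr ⟨by rwa [isAddUnit_iff_eq_zero], fun a b hab => ?_⟩
        rw [isAddUnit_iff_eq_zero, isAddUnit_iff_eq_zero, or_iff_not_imp_left]
        exact h a b hab
      have hpos : ∀ c : M, c ≠ 0 → 0 < ∑ i, c.1 i := by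
        intro c hc
        by_contra h0
        refine hc (Subtype.ext (funext fun i => ?_))
        exact Finset.sum_eq_zero_iff.1 (Nat.eq_zero_of_not_pos h0) i (Finset.mem_univ i)
      have hsum : ∑ i, a.1 i + ∑ i, b.1 i = n := by
        rw [← hs, ← Finset.sum_add_distrib]
        rfl
      have ha' := hpos a ha
      have hb' := hpos b hb
      obtain ⟨x, rfl⟩ := ih _ (by omega) a rfl
      obtain ⟨y, rfl⟩ := ih _ (by omega) b rfl
      exact ⟨x + y, map_add _ _ _⟩
  exact fun s => key _ s rfl

/-- Moving the exponent of `g j` to `g i` does not change a product if `g i = g j`. -/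
lemma prod_pow_merge [DecidableEq ι] {g : ι → G} {i j : ι} (hij : i ≠ j) (h : g i = g j)
    (α : ι → ℕ) :
    ∏ k : {k // k ≠ j}, g k ^ (α k + if (k : ι) = i then α j else 0) = ∏ k, g k ^ α k := by
  have h₁ : ∏ k : {k // k ≠ j}, g k ^ (if (k : ι) = i then α j else 0) = g j ^ α j := by
    rw [Fintype.prod_eq_single (⟨i, hij⟩ : {k // k ≠ j}), if_pos rfl, h]
    intro k hk
    rw [if_neg fun h' => hk (Subtype.ext h'), pow_zero]
  simp only [pow_add, Finset.prod_mul_distrib]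
  rw [h₁, mul_comm]
  exact (Fintype.prod_eq_mul_prod_subtype_ne (fun k => g k ^ α k) j).symm

/-- If `g i = g j`, then the monoid of `g` arises from that of the family without `g j` by
splitting the exponent of `g i`. -/
def splittingOfEq [DecidableEq ι] {g : ι → G} {i j : ι} (hij : i ≠ j) (h : g i = g j) :
    Splitting (ofFamily g) (ofFamily fun k : {k // k ≠ j} => g k) where
  base :=
    { toFun := fun α => ⟨fun k => α.1 k + if (k : ι) = i then α.1 j else 0, by
        rw [mem_ofFamily, prod_pow_merge hij h]
        exact α.2⟩
      map_zero' := by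
        refine Subtype.ext (funext fun k => ?_)
        change 0 + (if (k : ι) = i then 0 else 0) = 0
        simp
      map_add' := by
        intro α β
        refine Subtype.ext (funext fun k => ?_)
        change (α.1 k + β.1 k) + (if (k : ι) = i then α.1 j + β.1 j else 0) =
          (α.1 k + if (k : ι) = i then α.1 j else 0) + (β.1 k + if (k : ι) = i then β.1 j else 0)
        split_ifs <;> omega }
  part :=
    { toFun := fun α => α.1 j
      map_zero' := rfl
      map_add' := fun _ _ => rfl }
  total :=
    { toFun := fun β => β.1 ⟨i, hij⟩
      map_zero' := rfl
      map_add' := fun _ _ => rfl }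
  part_le α := by
    change α.1 j ≤ α.1 i + if i = i then α.1 j else 0
    rw [if_pos rfl]
    exact Nat.le_add_left _ _
  ext α β hb hp := by
    change α.1 j = β.1 j at hp
    refine Subtype.ext (funext fun k => ?_)
    by_cases hk : k = j
    · rw [hk, hp]
    · have : α.1 k + (if k = i then α.1 j else 0) = β.1 k + (if k = i then β.1 j else 0) :=
        congrFun (congrArg Subtype.val hb) ⟨k, hk⟩
      rw [hp] at this
      exact Nat.add_right_cancel this
  exists_of_le β n hn := by
    change n ≤ β.1 ⟨i, hij⟩ at hn
    let α : ι → ℕ := fun k =>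
      if hk : k = j then n else β.1 ⟨k, hk⟩ - if k = i then n else 0
    have hα : ∀ k : {k // k ≠ j}, α k + (if (k : ι) = i then α j else 0) = β.1 k := by
      rintro ⟨k, hk⟩
      simp only [α, dif_neg hk, dif_pos]
      split_ifs with hki
      · subst hki
        exact Nat.sub_add_cancel hn
      · rfl
    have hmem : α ∈ ofFamily g := by
      rw [mem_ofFamily, ← prod_pow_merge hij h]
      simp only [hα]
      exact β.2
    exact ⟨⟨α, hmem⟩, Subtype.ext (funext hα), dif_pos rfl⟩

/-- The monoid of an injective family only depends on the set of its values; this is a splitting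
of the coordinate zero. -/
def splittingOfInjective {g : ι → G} (hg : Function.Injective g) {G₀ : Finset G}
    (hG₀ : Set.range g = G₀) : Splitting (ofFamily g) (ofFinset G₀) :=
  let e : ι ≃ G₀ := (Equiv.ofInjective g hg).trans (Equiv.setCongr hG₀)
  have hprod : ∀ α : ι → ℕ, ∏ h : G₀, (h : G) ^ α (e.symm h) = ∏ i, g i ^ α i := fun α =>
    (Fintype.prod_equiv e _ _ fun i => by rw [e.symm_apply_apply]; rfl).symm
  { base :=
      { toFun := fun α => ⟨fun h => α.1 (e.symm h), (hprod α.1).trans α.2⟩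
        map_zero' := rfl
        map_add' := fun _ _ => rfl }
    part := 0
    total := 0
    part_le := fun _ => le_rfl
    ext := fun α β h _ => Subtype.ext (funext fun i => by
      have : α.1 (e.symm (e i)) = β.1 (e.symm (e i)) := congrFun (congrArg Subtype.val h) (e i)
      rwa [e.symm_apply_apply] at this)
    exists_of_le := fun β n hn => by
      refine ⟨⟨fun i => β.1 (e i), ?_⟩, Subtype.ext (funext fun h => ?_), (Nat.le_zero.1 hn).symm⟩
      · rw [mem_ofFamily, ← hprod]
        simp only [e.apply_symm_apply]
        exact β.2
      · exact congrArg β.1 (e.apply_symm_apply h) }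

instance finite_atom_ofFinset (G₀ : Finset G) : Finite (Atom (ofFinset G₀)) :=
  finite_atom_ofFamily (fun h : G₀ => (h : G))

/-- Repeated values of the family are removed one by one. -/
theorem hasQuadraticGroebnerSystem_ofFamily {G₀ : Finset G}
    (h₀ : HasQuadraticGroebnerSystem (ofFinset G₀)) (n : ℕ) :
    ∀ {ι : Type u} [Fintype ι] (g : ι → G), Fintype.card ι = n → Set.range g = G₀ →
      HasQuadraticGroebnerSystem (ofFamily g) := by
  classical
  induction n with
  | zero =>
    intro ι _ g hn hg
    have := Fintype.card_eq_zero_iff.1 hn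
    exact (splittingOfInjective (Function.injective_of_subsingleton g)
      hg).hasQuadraticGroebnerSystem h₀
  | succ n ih =>
    intro ι _ g hn hg
    by_cases hinj : Function.Injective g
    · exact (splittingOfInjective hinj hg).hasQuadraticGroebnerSystem h₀
    · simp only [Function.Injective, not_forall] at hinj
      obtain ⟨i, j, hij, hne⟩ := hinj
      refine (splittingOfEq hne hij).hasQuadraticGroebnerSystem (ih _ ?_ ?_)
      · rw [Fintype.card_subtype_compl, Fintype.card_subtype_eq, hn, Nat.add_sub_cancel]
      · rw [← hg]
        refine Set.Subset.antisymm ?_ ?_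
        · rintro _ ⟨k, rfl⟩
          exact ⟨k, rfl⟩
        · rintro _ ⟨k, rfl⟩
          by_cases hk : k = j
          · exact ⟨⟨i, hne⟩, hij.trans (by rw [hk])⟩
          · exact ⟨⟨k, hk⟩, rfl⟩

end Families

end BlockMonoid

theorem corollary5p5 {G : Type*} [CommGroup G] {m : ℕ} (g : Fin m → G)
    (h : BlockMonoid.HasQuadraticGroebnerSystem
      (BlockMonoid.ofFinset (BlockMonoid.supp g))) :
    BlockMonoid.HasQuadraticGroebnerSystem (BlockMonoid.ofTuple g) ∧
    ∃ _ : GradedAlgebra (BlockMonoid.lengthGrading (BlockMonoid.ofTuple g) ℂ),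
      BlockMonoid.IsKoszul (BlockMonoid.lengthGrading (BlockMonoid.ofTuple g) ℂ) := by
  have hg : Set.range g = BlockMonoid.supp g := (Set.Finite.coe_toFinset _).symm
  have hquad : BlockMonoid.HasQuadraticGroebnerSystem (BlockMonoid.ofTuple g) :=
    BlockMonoid.hasQuadraticGroebnerSystem_ofFamily h _ g rfl hg
  have : Finite (BlockMonoid.Atom (BlockMonoid.ofTuple g)) :=
    BlockMonoid.finite_atom_ofFamily g
  obtain ⟨o, ho⟩ := BlockMonoid.hasQuadraticGroebnerSystem_iff.1 hquad
  exact ⟨hquad, BlockMonoid.exists_gradedAlgebra_isKoszul ℂ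
    (BlockMonoid.factorization_surjective _) ho⟩
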